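/- Let $M$ be a smooth $4$-dimensional manifold. A \emph{Finsler spacetime} $(M,\mathcal A,F)$ consists of an open conic subset $\mathcal A\subset TM$ with non-empty fibers ($(x,y)\in\mathcal A$ and $\lambda>0$ imply $(x,\lambda y)\in\mathcal A$) and a smooth function $F:\mathcal A\to[0,\infty)$ with $F(x,\lambda y)=\lambda F(x,y)$ for $\lambda>0$, whose fundamental tensor $g_{ij}=\bar\partial_i\bar\partial_j\left(\tfrac12F^2\right)$ has Lorentzian signature on $\mathcal A$ (in either sign convention). Here $(x,y)$ are the coordinates of $TM$ induced by a chart of $M$, $\partial_i=\partial/\partial x^i$ and $\bar\partial_i=\partial/\partial y^i$. Put $$N^i_j=\tfrac14\bar\partial_j\Big(g^{ik}\big(y^l\partial_l\bar\partial_kF^2-\partial_kF^2\big)\Big),\qquad \delta_i=\partial_i-N^k_i\bar\partial_k,\qquad R^i{}_{jk}=\delta_jN^i_k-\delta_kN^i_j,$$ $$\mathrm{Ric}=R^i{}_{ij}\,y^j,\qquad R_{ij}=\tfrac12\bar\partial_i\bar\partial_j\mathrm{Ric}.$$ The spacetime is of \emph{Berwald type} if in every chart there are functions $\Gamma^i_{jk}(x)$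 with $N^i_j(x,y)=\Gamma^i_{jk}(x)y^k$ on $\mathcal A$. It is a \emph{Randers spacetime}, $F=\alpha+\beta$, if there are a smooth Lorentzian metric $a$ and a smooth $1$-form $b$ on $M$ such that on $\mathcal A$ one has $a_{ij}(x)y^iy^j>0$ and $F(x,y)=\alpha(x,y)+\beta(x,y)$ with $\alpha=\sqrt{a_{ij}(x)y^iy^j}$ and $\beta=b_i(x)y^i$. The vacuum Finsler gravity equation for spacetimes of Berwald type is $$\Big(g^{ij}-\frac{3}{F^2}\,y^iy^j\Big)R_{ij}=0\qquad\text{on }\mathcal A.$$ \textbf{Theorem.} Let $(M,\mathcal A,F)$, $F=\alpha+\beta$, be a Randers spacetime of Berwald type. Then $F$ solves the vacuum Finsler gravity equation if and only if the Lorentzian metric $a$ defining $\alpha$ solves the vacuum Einstein equations, i.e. the Ricci tensor of the Levi-Civita connection of $a$ vanishes on $M$. -/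

import Mathlib

open scoped Manifold ContDiff

noncomputable section

namespace FinslerGravity

/-- The coordinate space of a four-dimensional manifold. -/
abbrev E4 := EuclideanSpace ℝ (Fin 4)

-- `E4` carries its standard smooth structure, with the identity as its only chart.
attribute [local instance 2000] chartedSpaceSelf

/-! ### Calculus in local coordinates `(x, y)` of the tangent bundle -/

/-- A function of the bundle coordinates `(x, y)`. -/
abbrev LocalFun := E4 → E4 → ℝ

/-- The partial derivative `∂ᵢ f = ∂f/∂xⁱ` with respect to the position. -/
def dx (i : Fin 4) (f : LocalFun) : LocalFun :=
  fun x y => fderiv ℝ (fun x' => f x' y) x (EuclideanSpace.single i 1)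

/-- The partial derivative `∂̄ᵢ f = ∂f/∂yⁱ` with respect to the direction. -/
def dy (i : Fin 4) (f : LocalFun) : LocalFun :=
  fun x y => fderiv ℝ (fun y' => f x y') y (EuclideanSpace.single i 1)

/-- The partial derivative `∂ᵢ f` of a function of the position only. -/
def partialDeriv (i : Fin 4) (f : E4 → ℝ) : E4 → ℝ :=
  fun x => fderiv ℝ f x (EuclideanSpace.single i 1)

/-- A real `4 × 4` matrix is Lorentzian if it is congruent to `diag(1, -1, -1, -1)` or to
`diag(-1, 1, 1, 1)` (both sign conventions are allowed). -/
def IsLorentzianMatrix (B : Matrix (Fin 4) (Fin 4) ℝ) : Prop :=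
  ∃ P : Matrix (Fin 4) (Fin 4) ℝ, IsUnit P.det ∧
    (P.transpose * B * P = Matrix.diagonal ![1, -1, -1, -1] ∨
      P.transpose * B * P = Matrix.diagonal ![-1, 1, 1, 1])

/-! ### Finsler geometry in local coordinates; `F` is the local Finsler function -/

/-- The fundamental tensor `g_ij = ∂̄ᵢ ∂̄ⱼ (F² / 2)`. -/
def fundamentalTensor (F : LocalFun) (x y : E4) : Matrix (Fin 4) (Fin 4) ℝ :=
  Matrix.of fun i j => dy i (dy j (fun x' y' => (1 / 2) * F x' y' ^ 2)) x y

/-- The Cartan non-linear connection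
`Nⁱⱼ = (1/4) ∂̄ⱼ (gⁱᵏ (yˡ ∂ₗ ∂̄ₖ F² - ∂ₖ F²))`. -/
def cartanConnection (F : LocalFun) (i j : Fin 4) : LocalFun :=
  fun x y => (1 / 4) * dy j (fun x' y' => ∑ k, (fundamentalTensor F x' y')⁻¹ i k *
    ((∑ l, y' l * dx l (dy k (fun x'' y'' => F x'' y'' ^ 2)) x' y') -
      dx k (fun x'' y'' => F x'' y'' ^ 2) x' y')) x y

/-- The horizontal derivative `δᵢ f = ∂ᵢ f - Nᵏᵢ ∂̄ₖ f`. -/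
def horizontalDeriv (F : LocalFun) (i : Fin 4) (f : LocalFun) : LocalFun :=
  fun x y => dx i f x y - ∑ k, cartanConnection F k i x y * dy k f x y

/-- The curvature `Rⁱⱼₖ = δⱼ Nⁱₖ - δₖ Nⁱⱼ` of the Cartan non-linear connection. -/
def nonlinearCurvature (F : LocalFun) (i j k : Fin 4) : LocalFun :=
  fun x y => horizontalDeriv F j (cartanConnection F i k) x y -
    horizontalDeriv F k (cartanConnection F i j) x y

/-- The curvature scalar `Ric = Rⁱᵢⱼ yʲ`. -/
def finslerRic (F : LocalFun) : LocalFun :=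
  fun x y => ∑ i, ∑ j, nonlinearCurvature F i i j x y * y j

/-- The Finsler Ricci tensor `R_ij = (1/2) ∂̄ᵢ ∂̄ⱼ Ric`. -/
def finslerRicci (F : LocalFun) (i j : Fin 4) : LocalFun :=
  fun x y => (1 / 2) * dy i (dy j (finslerRic F)) x y

/-- The left-hand side `(gⁱʲ - (3 / F²) yⁱ yʲ) R_ij` of the vacuum field equation of Finsler gravity
(for Berwald spacetimes). -/
def fieldOperator (F : LocalFun) : LocalFun :=
  fun x y => ∑ i, ∑ j, ((fundamentalTensor F x y)⁻¹ i j - 3 / F x y ^ 2 * (y i * y j)) *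
    finslerRicci F i j x y

/-! ### Pseudo-Riemannian geometry in local coordinates; `a` is the local metric `a_ij(x)` -/

/-- The Christoffel symbols
`Γⁱⱼₖ = (1/2) aⁱˡ (∂ⱼ a_lk + ∂ₖ a_lj - ∂ₗ a_jk)` of the Levi-Civita connection. -/
def christoffel (a : E4 → Matrix (Fin 4) (Fin 4) ℝ) (i j k : Fin 4) : E4 → ℝ :=
  fun x => (1 / 2) * ∑ l, (a x)⁻¹ i l *
    (partialDeriv j (fun x' => a x' l k) x + partialDeriv k (fun x' => a x' l j) x -
      partialDeriv l (fun x' => a x' j k) x)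

/-- The Riemann curvature tensor
`R̄ₗⁱⱼₖ = ∂ⱼ Γⁱₖₗ - ∂ₖ Γⁱⱼₗ + Γⁱₘⱼ Γᵐₖₗ - Γⁱₘₖ Γᵐⱼₗ`. -/
def riemannCurvature (a : E4 → Matrix (Fin 4) (Fin 4) ℝ) (l i j k : Fin 4) : E4 → ℝ :=
  fun x => partialDeriv j (christoffel a i k l) x - partialDeriv k (christoffel a i j l) x +
    ∑ m, (christoffel a i m j x * christoffel a m k l x -
      christoffel a i m k x * christoffel a m j l x)

/-- The Ricci tensor `R̄ₗₖ = R̄ₗⁱᵢₖ`. -/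
def ricci (a : E4 → Matrix (Fin 4) (Fin 4) ℝ) (l k : Fin 4) : E4 → ℝ :=
  fun x => ∑ i, riemannCurvature a l i i k x

/-! ### Manifolds -/

section Manifold

variable {M : Type*} [TopologicalSpace M] [ChartedSpace E4 M]

/-- The tangent vector `yⁱ ∂ᵢ` at the point with coordinates `x` in the chart `φ`. -/
def coordVector (φ : OpenPartialHomeomorph M E4) (x y : E4) :
    TangentSpace 𝓘(ℝ, E4) (φ.symm x) :=
  mfderiv 𝓘(ℝ, E4) 𝓘(ℝ, E4) φ.symm x y

/-- The point of the tangent bundle with the bundle coordinates `(x, y)` induced by the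
chart `φ`. -/
def coordPoint (φ : OpenPartialHomeomorph M E4) (x y : E4) : TangentBundle 𝓘(ℝ, E4) M :=
  ⟨φ.symm x, coordVector φ x y⟩

/-- The expression of a function on the tangent bundle in the bundle coordinates induced by the
chart `φ`. -/
def localExpr (φ : OpenPartialHomeomorph M E4) (F : TangentBundle 𝓘(ℝ, E4) M → ℝ) : LocalFun :=
  fun x y => F (coordPoint φ x y)

variable [IsManifold 𝓘(ℝ, E4) ∞ M]

/-- The component matrix `a_ij = a(∂ᵢ, ∂ⱼ)` of a `(0,2)`-tensor field in the chart `φ`. -/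
def localMetric (φ : OpenPartialHomeomorph M E4)
    (a : ∀ p : M, TangentSpace 𝓘(ℝ, E4) p →L[ℝ] TangentSpace 𝓘(ℝ, E4) p →L[ℝ] ℝ)
    (x : E4) : Matrix (Fin 4) (Fin 4) ℝ :=
  Matrix.of fun i j => a (φ.symm x)
    (coordVector φ x (EuclideanSpace.single i 1)) (coordVector φ x (EuclideanSpace.single j 1))

variable (M)

/-- A smooth Lorentzian metric on the four-dimensional smooth manifold `M`. -/
structure LorentzianMetric where
  /-- The bilinear form on each tangent space. -/
  val : ∀ p : M, TangentSpace 𝓘(ℝ, E4) p →L[ℝ] TangentSpace 𝓘(ℝ, E4) p →L[ℝ] ℝ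
  symm : ∀ (p : M) (v w : TangentSpace 𝓘(ℝ, E4) p), val p v w = val p w v
  smooth : ContMDiff 𝓘(ℝ, E4) (𝓘(ℝ, E4).prod 𝓘(ℝ, E4 →L[ℝ] E4 →L[ℝ] ℝ)) ∞
    (fun p => Bundle.TotalSpace.mk' (E4 →L[ℝ] E4 →L[ℝ] ℝ) p (val p))
  lorentzian : ∀ φ ∈ IsManifold.maximalAtlas 𝓘(ℝ, E4) ∞ M, ∀ x ∈ φ.target,
    IsLorentzianMatrix (localMetric φ val x)

/-- A smooth 1-form on the smooth manifold `M`. -/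
structure OneForm where
  /-- The linear form on each tangent space. -/
  val : ∀ p : M, TangentSpace 𝓘(ℝ, E4) p →L[ℝ] ℝ
  smooth : ContMDiff 𝓘(ℝ, E4) (𝓘(ℝ, E4).prod 𝓘(ℝ, E4 →L[ℝ] ℝ)) ∞
    (fun p => Bundle.TotalSpace.mk' (E4 →L[ℝ] ℝ) p (val p))

/-- A four-dimensional Finsler spacetime `(M, 𝒜, F)`: `𝒜` is an open conic subset of `TM` with
non-empty fibers, and `F : 𝒜 → [0, ∞)` is smooth, positively homogeneous of degree one, and has a
fundamental tensor of Lorentzian signature. The values of `F` outside `𝒜` play no role. -/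
structure FinslerSpacetime where
  /-- The conic domain `𝒜`. -/
  domain : Set (TangentBundle 𝓘(ℝ, E4) M)
  isOpen_domain : IsOpen domain
  nonempty_fiber : ∀ p : M, ∃ v : TangentSpace 𝓘(ℝ, E4) p,
    (⟨p, v⟩ : TangentBundle 𝓘(ℝ, E4) M) ∈ domain
  conic : ∀ (p : M) (v : TangentSpace 𝓘(ℝ, E4) p) (c : ℝ), 0 < c →
    (⟨p, v⟩ : TangentBundle 𝓘(ℝ, E4) M) ∈ domain →
    (⟨p, c • v⟩ : TangentBundle 𝓘(ℝ, E4) M) ∈ domain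
  /-- The Finsler function `F`. -/
  F : TangentBundle 𝓘(ℝ, E4) M → ℝ
  nonneg : ∀ z ∈ domain, 0 ≤ F z
  smooth : ContMDiffOn 𝓘(ℝ, E4).tangent 𝓘(ℝ, ℝ) ∞ F domain
  homogeneous : ∀ (p : M) (v : TangentSpace 𝓘(ℝ, E4) p) (c : ℝ), 0 < c →
    (⟨p, v⟩ : TangentBundle 𝓘(ℝ, E4) M) ∈ domain → F ⟨p, c • v⟩ = c * F ⟨p, v⟩
  lorentzian : ∀ φ ∈ IsManifold.maximalAtlas 𝓘(ℝ, E4) ∞ M, ∀ x ∈ φ.target, ∀ y : E4,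
    coordPoint φ x y ∈ domain → IsLorentzianMatrix (fundamentalTensor (localExpr φ F) x y)

variable {M}

/-- The Finsler spacetime is of Randers type, `F = α + β` on `𝒜`, with `α(v) = √(a(v, v))` for the
Lorentzian metric `a` and `β(v) = b(v)` for the 1-form `b`; in particular `a(v, v) > 0` on `𝒜`, so
that `α` is real and non-vanishing there. -/
def FinslerSpacetime.IsRanders (S : FinslerSpacetime M) (a : LorentzianMetric M) (b : OneForm M) :
    Prop :=
  ∀ (p : M) (v : TangentSpace 𝓘(ℝ, E4) p), (⟨p, v⟩ : TangentBundle 𝓘(ℝ, E4) M) ∈ S.domain →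
    0 < a.val p v v ∧ S.F ⟨p, v⟩ = Real.sqrt (a.val p v v) + b.val p v

/-- The Finsler spacetime is of Berwald type: in all local coordinates the Cartan non-linear
connection is linear, `Nⁱⱼ(x, y) = Γⁱⱼₖ(x) yᵏ` on `𝒜`. -/
def FinslerSpacetime.IsBerwald (S : FinslerSpacetime M) : Prop :=
  ∀ φ ∈ IsManifold.maximalAtlas 𝓘(ℝ, E4) ∞ M, ∃ Γ : Fin 4 → Fin 4 → Fin 4 → E4 → ℝ,
    ∀ x ∈ φ.target, ∀ y : E4, coordPoint φ x y ∈ S.domain → ∀ i j : Fin 4,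
      cartanConnection (localExpr φ S.F) i j x y = ∑ k, Γ i j k x * y k

/-- The Finsler function (of a spacetime of Berwald type) solves the vacuum field equation of
Finsler gravity, `(gⁱʲ - (3 / F²) yⁱ yʲ) R_ij = 0` on `𝒜`. -/
def FinslerSpacetime.SolvesVacuumFinslerGravity (S : FinslerSpacetime M) : Prop :=
  ∀ φ ∈ IsManifold.maximalAtlas 𝓘(ℝ, E4) ∞ M, ∀ x ∈ φ.target, ∀ y : E4,
    coordPoint φ x y ∈ S.domain → fieldOperator (localExpr φ S.F) x y = 0

/-- The Lorentzian metric solves the vacuum Einstein equations `R̄_ij = 0`. -/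
def LorentzianMetric.SolvesVacuumEinstein (a : LorentzianMetric M) : Prop :=
  ∀ φ ∈ IsManifold.maximalAtlas 𝓘(ℝ, E4) ∞ M, ∀ x ∈ φ.target, ∀ i j : Fin 4,
    ricci (localMetric φ a.val) i j x = 0

end Manifold

end FinslerGravity

end

/-!
Let `Γ` be the linear connection of the Berwald spacetime. The horizontal derivative of `F = α + β`
vanishes, and on an open subset of a fiber a polynomial and a polynomial multiple of
`α = √(a_ij yⁱ yʲ)` can only cancel if both are zero, because `a` is indefinite. Separating the two
parts of `δⱼ F = 0` gives `∇a = 0` and `∇b = 0`: the connection is the Levi-Civita connection of `a`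
and `b` is parallel. Hence the Finsler Ricci tensor is the Ricci tensor `S` of `a`, and `S`
annihilates the gradient `aⁱʲ bⱼ`. Inverting the fundamental tensor explicitly,
`F³ (gⁱʲ - (3 / F²) yⁱ yʲ) S_ij =
  2 β (R α² - S(y, y)) + α (R (α² + β²) + (|b|² - 3) S(y, y))`
with `R = aⁱʲ S_ij`. If this vanishes, so do both parts, which makes `S` proportional to `a` with
factor `R` (if `b ≠ 0`) or `R / 3` (if `b = 0`). Taking the trace in dimension four gives `R = 0`
and `S = 0`.
-/

open scoped Matrix Topology

noncomputable section

namespace FinslerGravity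

section LinearAlgebra

variable {ι K : Type*} [Fintype ι] [Field K]

lemma dotProduct_mulVec_comm {S : Matrix ι ι K} (hS : S.IsSymm) (v w : ι → K) :
    v ⬝ᵥ S *ᵥ w = w ⬝ᵥ S *ᵥ v := by
  rw [Matrix.dotProduct_mulVec, ← Matrix.mulVec_transpose, hS.eq, dotProduct_comm]

lemma eq_zero_of_dotProduct_mulVec_self_eq_zero [NeZero (2 : K)] {S : Matrix ι ι K}
    (hS : S.IsSymm) (h : ∀ v, v ⬝ᵥ S *ᵥ v = 0) : S = 0 := by
  classical
  have polar : ∀ v w, v ⬝ᵥ S *ᵥ w = 0 := fun v w => by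
    have hvw := h (v + w)
    simp only [Matrix.mulVec_add, dotProduct_add, add_dotProduct, h,
      dotProduct_mulVec_comm hS w v, zero_add, add_zero, ← two_mul] at hvw
    exact (mul_eq_zero.1 hvw).resolve_left two_ne_zero
  ext i j
  simpa using polar (Pi.single i 1) (Pi.single j 1)

variable [DecidableEq ι]

lemma eq_zero_of_smul_eq_trace_smul {a S : Matrix ι ι K} {c : K} (ha : IsUnit a.det)
    (hc : c ≠ 0) (hcard : c ≠ Fintype.card ι) (h : c • S = (a⁻¹ * S).trace • a) : S = 0 := by
  have htr : c * (a⁻¹ * S).trace = (a⁻¹ * S).trace * Fintype.card ι := by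
    simpa [Matrix.mul_smul, Matrix.nonsing_inv_mul a ha] using
      congrArg (fun T => (a⁻¹ * T).trace) h
  have : (c - Fintype.card ι) * (a⁻¹ * S).trace = 0 := by linear_combination htr
  rw [(mul_eq_zero.1 this).resolve_left (sub_ne_zero.2 hcard), zero_smul] at h
  exact (smul_eq_zero.1 h).resolve_left hc

lemma eq_zero_of_mul_dotProduct_mulVec_self_eq [NeZero (2 : K)] {a S : Matrix ι ι K} {c : K}
    (ha : IsUnit a.det) (hsymm : a.IsSymm) (hS : S.IsSymm) (hc : c ≠ 0)
    (hcard : c ≠ Fintype.card ι)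
    (h : ∀ v, c * (v ⬝ᵥ S *ᵥ v) = (a⁻¹ * S).trace * (v ⬝ᵥ a *ᵥ v)) : S = 0 := by
  refine eq_zero_of_smul_eq_trace_smul ha hc hcard (sub_eq_zero.1 ?_)
  refine eq_zero_of_dotProduct_mulVec_self_eq_zero ((hS.smul c).sub (hsymm.smul _)) fun v => ?_
  rw [Matrix.sub_mulVec, Matrix.smul_mulVec, Matrix.smul_mulVec, dotProduct_sub, dotProduct_smul,
    dotProduct_smul, smul_eq_mul, smul_eq_mul, h v, sub_self]

lemma trace_eq_zero_of_transpose_mul_add_mul_eq_zero [NeZero (2 : K)]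
    {a R : Matrix ι ι K} (ha : IsUnit a.det)
    (h : Rᵀ * a + a * R = 0) : R.trace = 0 := by
  have hR : a⁻¹ * (Rᵀ * a) + R = 0 := by
    simpa [Matrix.mul_add, Matrix.nonsing_inv_mul_cancel_left a R ha] using congrArg (a⁻¹ * ·) h
  have htr := congrArg Matrix.trace hR
  rw [Matrix.trace_add, Matrix.trace_mul_comm, Matrix.mul_nonsing_inv_cancel_right _ _ ha,
    Matrix.trace_transpose, Matrix.trace_zero, ← two_mul] at htr
  exact (mul_eq_zero.1 htr).resolve_left two_ne_zero

lemma mulVec_inv_mulVec_eq_zero {a R : Matrix ι ι K} {b : ι → K} (ha : IsUnit a.det)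
    (h : Rᵀ * a + a * R = 0) (hb : b ᵥ* R = 0) : R *ᵥ (a⁻¹ *ᵥ b) = 0 := by
  have hR : a * (R * a⁻¹) = -Rᵀ := by
    rw [← Matrix.mul_assoc, eq_neg_of_add_eq_zero_right h, Matrix.neg_mul,
      Matrix.mul_nonsing_inv_cancel_right _ _ ha]
  rw [Matrix.mulVec_mulVec, ← Matrix.nonsing_inv_mul_cancel_left a (R * a⁻¹) ha, hR,
    ← Matrix.mulVec_mulVec, Matrix.neg_mulVec, Matrix.mulVec_transpose, hb, neg_zero,
    Matrix.mulVec_zero]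

end LinearAlgebra

section RandersTensor

variable {ι K : Type*} [Fintype ι] [Field K]

/-- The algebraic form `(F/α)(a - n ⊗ n) + (n + b) ⊗ (n + b)`, with `n = ay/α` and `F = α + b(y)`,
of the fundamental tensor of a Randers function at `y`. The norm `α` is an independent variable, to
be specialised to a square root of `a(y, y)`. -/
def randersTensor (a : Matrix ι ι K) (b y : ι → K) (α : K) : Matrix ι ι K :=
  ((α + b ⬝ᵥ y) / α) • (a - Matrix.vecMulVec (α⁻¹ • a *ᵥ y) (α⁻¹ • a *ᵥ y)) +
    Matrix.vecMulVec (α⁻¹ • a *ᵥ y + b) (α⁻¹ • a *ᵥ y + b)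

variable {a S : Matrix ι ι K} {b y : ι → K} {α : K}

lemma vecMulVec_mulVec_eq_smul (u v w : ι → K) :
    Matrix.vecMulVec u v *ᵥ w = (v ⬝ᵥ w) • u := by
  rw [Matrix.vecMulVec_mulVec, op_smul_eq_smul]

lemma randersTensor_mulVec_self (hα : α ≠ 0) (hy : α ^ 2 = y ⬝ᵥ a *ᵥ y) :
    randersTensor a b y α *ᵥ y = (α + b ⬝ᵥ y) • (α⁻¹ • a *ᵥ y + b) := by
  have hn : (α⁻¹ • a *ᵥ y) ⬝ᵥ y = α := by
    rw [smul_dotProduct, dotProduct_comm, ← hy, smul_eq_mul]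
    field_simp
  rw [randersTensor, Matrix.add_mulVec, Matrix.smul_mulVec, Matrix.sub_mulVec,
    vecMulVec_mulVec_eq_smul, vecMulVec_mulVec_eq_smul, add_dotProduct, hn, smul_smul,
    mul_inv_cancel₀ hα, one_smul, sub_self, smul_zero, zero_add]

variable [DecidableEq ι]

lemma randersTensor_mulVec_inv_mulVec (ha : IsUnit a.det) (hsymm : a.IsSymm) :
    randersTensor a b y α *ᵥ (a⁻¹ *ᵥ b) =
      ((α + b ⬝ᵥ y) / α) • (b - (b ⬝ᵥ y / α) • α⁻¹ • a *ᵥ y) +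
        (b ⬝ᵥ y / α + b ⬝ᵥ a⁻¹ *ᵥ b) • (α⁻¹ • a *ᵥ y + b) := by
  have hn : (α⁻¹ • a *ᵥ y) ⬝ᵥ a⁻¹ *ᵥ b = b ⬝ᵥ y / α := by
    rw [smul_dotProduct, dotProduct_mulVec_comm hsymm.inv, Matrix.mulVec_mulVec,
      Matrix.nonsing_inv_mul a ha, Matrix.one_mulVec, smul_eq_mul, div_eq_inv_mul]
  rw [randersTensor, Matrix.add_mulVec, Matrix.smul_mulVec, Matrix.sub_mulVec,
    vecMulVec_mulVec_eq_smul, vecMulVec_mulVec_eq_smul, add_dotProduct, hn, Matrix.mulVec_mulVec,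
    Matrix.mul_nonsing_inv a ha, Matrix.one_mulVec]

lemma vecMul_inv_mul (hsymm : a.IsSymm) (hS : S.IsSymm) (v : ι → K) :
    v ᵥ* (a⁻¹ * S) = S *ᵥ (a⁻¹ *ᵥ v) := by
  rw [← Matrix.vecMul_vecMul, ← Matrix.mulVec_transpose, ← Matrix.mulVec_transpose, hS.eq,
    hsymm.inv.eq]

lemma randersTensor_mul_inv_mul (ha : IsUnit a.det) (hsymm : a.IsSymm) (hS : S.IsSymm)
    (hb : S *ᵥ (a⁻¹ *ᵥ b) = 0) :
    randersTensor a b y α * (a⁻¹ * S) =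
      ((α + b ⬝ᵥ y) / α) • S +
        Matrix.vecMulVec (α⁻¹ • (α⁻¹ • a *ᵥ y + b) - ((α + b ⬝ᵥ y) / α) • α⁻¹ • α⁻¹ • a *ᵥ y)
          (S *ᵥ y) := by
  have hn : (α⁻¹ • a *ᵥ y) ᵥ* (a⁻¹ * S) = α⁻¹ • S *ᵥ y := by
    rw [vecMul_inv_mul hsymm hS, Matrix.mulVec_smul, Matrix.mulVec_mulVec,
      Matrix.nonsing_inv_mul a ha, Matrix.one_mulVec, Matrix.mulVec_smul]
  rw [randersTensor, Matrix.add_mul, Matrix.smul_mul, Matrix.sub_mul,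
    Matrix.mul_nonsing_inv_cancel_left a S ha, Matrix.vecMulVec_mul, Matrix.vecMulVec_mul,
    Matrix.add_vecMul, hn, vecMul_inv_mul hsymm hS, hb, add_zero]
  ext i j
  simp only [Matrix.add_apply, Matrix.sub_apply, Matrix.smul_apply, Matrix.vecMulVec_apply,
    Pi.add_apply, Pi.sub_apply, Pi.smul_apply, smul_eq_mul]
  ring

/-- The matrix `g⁻¹ S` for the Randers tensor `g`, when `S` annihilates the vector `a⁻¹ b`. -/
def randersInvMul (a S : Matrix ι ι K) (b y : ι → K) (α : K) : Matrix ι ι K :=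
  (α / (α + b ⬝ᵥ y)) • (a⁻¹ * S) +
    Matrix.vecMulVec (((b ⬝ᵥ y + α * (b ⬝ᵥ a⁻¹ *ᵥ b)) / (α + b ⬝ᵥ y) ^ 3) • y -
      (α / (α + b ⬝ᵥ y) ^ 2) • a⁻¹ *ᵥ b) (S *ᵥ y)

lemma randersTensor_mul_randersInvMul (ha : IsUnit a.det) (hsymm : a.IsSymm) (hS : S.IsSymm)
    (hb : S *ᵥ (a⁻¹ *ᵥ b) = 0) (hα : α ≠ 0) (hF : α + b ⬝ᵥ y ≠ 0) (hy : α ^ 2 = y ⬝ᵥ a *ᵥ y) :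
    randersTensor a b y α * randersInvMul a S b y α = S := by
  rw [randersInvMul, Matrix.mul_add, Matrix.mul_smul, randersTensor_mul_inv_mul ha hsymm hS hb,
    Matrix.mul_vecMulVec, Matrix.mulVec_sub, Matrix.mulVec_smul, Matrix.mulVec_smul,
    randersTensor_mulVec_self hα hy, randersTensor_mulVec_inv_mulVec ha hsymm]
  ext i j
  simp only [Matrix.add_apply, Matrix.smul_apply, Matrix.vecMulVec_apply, Pi.add_apply,
    Pi.sub_apply, Pi.smul_apply, smul_eq_mul]
  field_simp
  ring

lemma trace_randersTensor_inv_mul (ha : IsUnit a.det) (hsymm : a.IsSymm) (hS : S.IsSymm)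
    (hb : S *ᵥ (a⁻¹ *ᵥ b) = 0) (hα : α ≠ 0) (hF : α + b ⬝ᵥ y ≠ 0) (hy : α ^ 2 = y ⬝ᵥ a *ᵥ y)
    (hg : IsUnit (randersTensor a b y α).det) :
    ((randersTensor a b y α)⁻¹ * S).trace = α / (α + b ⬝ᵥ y) * (a⁻¹ * S).trace +
      (b ⬝ᵥ y + α * (b ⬝ᵥ a⁻¹ *ᵥ b)) / (α + b ⬝ᵥ y) ^ 3 * (y ⬝ᵥ S *ᵥ y) := by
  have hinv : (randersTensor a b y α)⁻¹ * S = randersInvMul a S b y α := by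
    conv_lhs => rw [← randersTensor_mul_randersInvMul ha hsymm hS hb hα hF hy]
    exact Matrix.nonsing_inv_mul_cancel_left _ _ hg
  rw [hinv, randersInvMul, Matrix.trace_add, Matrix.trace_smul, Matrix.trace_vecMulVec,
    sub_dotProduct, smul_dotProduct, smul_dotProduct, dotProduct_mulVec_comm hS (a⁻¹ *ᵥ b), hb]
  simp

end RandersTensor

section MatrixCalculus

variable {ι E : Type*} [Fintype ι] [DecidableEq ι] [NormedAddCommGroup E] [NormedSpace ℝ E]
  {s : Set E} {n : WithTop ℕ∞} {A : E → Matrix ι ι ℝ}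

lemma contDiffOn_det (hA : ∀ i j, ContDiffOn ℝ n (fun x => A x i j) s) :
    ContDiffOn ℝ n (fun x => (A x).det) s := by
  simp only [Matrix.det_apply]
  exact ContDiffOn.sum fun σ _ => (contDiffOn_prod fun i _ => hA _ _).const_smul _

lemma contDiffOn_inv_apply (hA : ∀ i j, ContDiffOn ℝ n (fun x => A x i j) s)
    (hdet : ∀ x ∈ s, (A x).det ≠ 0) (i j : ι) : ContDiffOn ℝ n (fun x => (A x)⁻¹ i j) s := by
  have hcofactor : ContDiffOn ℝ n (fun x => ((A x).updateRow j (Pi.single i 1)).det) s := by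
    refine contDiffOn_det fun k l => ?_
    rcases eq_or_ne k j with rfl | hk
    · simpa using contDiffOn_const
    · simpa [Matrix.updateRow_ne hk] using hA k l
  refine (((contDiffOn_det hA).inv hdet).mul hcofactor).congr fun x _ => ?_
  simp [Matrix.inv_def, Matrix.adjugate_apply]

end MatrixCalculus

lemma IsLorentzianMatrix.det_ne_zero {B : Matrix (Fin 4) (Fin 4) ℝ} (h : IsLorentzianMatrix B) :
    B.det ≠ 0 := by
  obtain ⟨P, -, h | h⟩ := h <;>
  · intro h0
    simpa [Matrix.det_mul, h0, Fin.prod_univ_four] using congrArg Matrix.det h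

lemma IsLorentzianMatrix.exists_dotProduct_mulVec_neg {B : Matrix (Fin 4) (Fin 4) ℝ}
    (h : IsLorentzianMatrix B) : ∃ v, v ⬝ᵥ B *ᵥ v < 0 := by
  obtain ⟨P, -, h⟩ := h
  have pullback : ∀ v, P *ᵥ v ⬝ᵥ B *ᵥ (P *ᵥ v) = v ⬝ᵥ (Pᵀ * B * P) *ᵥ v := fun v => by
    rw [← Matrix.mulVec_mulVec, ← Matrix.mulVec_mulVec, Matrix.dotProduct_mulVec v Pᵀ,
      Matrix.vecMul_transpose]
  rcases h with h | h
  · exact ⟨P *ᵥ Pi.single 1 1, by rw [pullback, h]; simp⟩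
  · exact ⟨P *ᵥ Pi.single 0 1, by rw [pullback, h]; simp⟩

section Analytic

variable {E : Type*} [NormedAddCommGroup E] [NormedSpace ℝ E] {f g A : E → ℝ}

lemma eq_zero_of_contDiff_omega_of_eqOn_isOpen (hf : ContDiff ℝ ω f) {s : Set E} (hs : IsOpen s)
    (hne : s.Nonempty) (h : ∀ v ∈ s, f v = 0) : f = 0 := by
  obtain ⟨v, hv⟩ := hne
  have hf' : AnalyticOnNhd ℝ f Set.univ := fun w _ => hf.contDiffAt.analyticAt
  exact hf'.eq_of_eventuallyEq (fun _ _ => analyticAt_const)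
    (Filter.eventuallyEq_of_mem (hs.mem_nhds hv) h)

lemma eq_zero_of_mul_eq_zero_of_contDiff_omega (hf : ContDiff ℝ ω f) (hg : ContDiff ℝ ω g)
    (h : ∀ v, f v * g v = 0) (hne : ∃ v, f v ≠ 0) : g = 0 :=
  eq_zero_of_contDiff_omega_of_eqOn_isOpen hg (isOpen_ne_fun hf.continuous continuous_const) hne
    fun v hv => (mul_eq_zero.1 (h v)).resolve_left hv

-- The hypothesis gives `f² = A g²` first on `s`, hence everywhere; where `A < 0` both sides vanish.
lemma eq_zero_of_add_sqrt_mul_eq_zero (hf : ContDiff ℝ ω f) (hg : ContDiff ℝ ω g)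
    (hA : ContDiff ℝ ω A) {s : Set E} (hs : IsOpen s) (hne : s.Nonempty) (hpos : ∀ v ∈ s, 0 < A v)
    (hneg : ∃ v, A v < 0) (h : ∀ v ∈ s, f v + √(A v) * g v = 0) : f = 0 ∧ g = 0 := by
  have hsq : (fun v => f v ^ 2 - A v * g v ^ 2) = 0 :=
    eq_zero_of_contDiff_omega_of_eqOn_isOpen (by fun_prop) hs hne fun v hv => by
      linear_combination (f v - √(A v) * g v) * h v hv + g v ^ 2 * Real.sq_sqrt (hpos v hv).le
  have hopen : IsOpen {v | A v < 0} := isOpen_lt hA.continuous continuous_const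
  have hvanish : ∀ v, A v < 0 → f v = 0 ∧ g v = 0 := fun v hv => by
    have hv2 : f v ^ 2 - A v * g v ^ 2 = 0 := congrFun hsq v
    have hfv : f v ^ 2 = 0 := by nlinarith [sq_nonneg (f v), sq_nonneg (g v)]
    have hgv : A v * g v ^ 2 = 0 := by linarith
    exact ⟨pow_eq_zero_iff two_ne_zero |>.1 hfv,
      pow_eq_zero_iff two_ne_zero |>.1 ((mul_eq_zero.1 hgv).resolve_left hv.ne)⟩
  exact ⟨eq_zero_of_contDiff_omega_of_eqOn_isOpen hf hopen hneg fun v hv => (hvanish v hv).1,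
    eq_zero_of_contDiff_omega_of_eqOn_isOpen hg hopen hneg fun v hv => (hvanish v hv).2⟩

end Analytic

lemma two_le_infty : (2 : WithTop ℕ∞) ≤ ∞ := WithTop.coe_le_coe.2 (le_top (a := (2 : ℕ∞)))

section PartialDeriv

variable {f g : E4 → ℝ} {x : E4}

lemma partialDeriv_congr (h : f =ᶠ[𝓝 x] g) (i : Fin 4) : partialDeriv i f x = partialDeriv i g x :=
  DFunLike.congr_fun h.fderiv_eq _

lemma partialDeriv_const (c : ℝ) (i : Fin 4) : partialDeriv i (fun _ => c) x = 0 := by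
  simp [partialDeriv]

lemma partialDeriv_add (hf : DifferentiableAt ℝ f x) (hg : DifferentiableAt ℝ g x) (i : Fin 4) :
    partialDeriv i (fun x => f x + g x) x = partialDeriv i f x + partialDeriv i g x := by
  simp [partialDeriv, fderiv_fun_add hf hg]

lemma partialDeriv_mul (hf : DifferentiableAt ℝ f x) (hg : DifferentiableAt ℝ g x) (i : Fin 4) :
    partialDeriv i (fun x => f x * g x) x =
      partialDeriv i f x * g x + f x * partialDeriv i g x := by
  simp only [partialDeriv, fderiv_fun_mul hf hg, add_apply, smul_apply, smul_eq_mul]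
  ring

lemma partialDeriv_const_mul (c : ℝ) (f : E4 → ℝ) (i : Fin 4) :
    partialDeriv i (fun x => c * f x) x = c * partialDeriv i f x :=
  DFunLike.congr_fun (congrFun (fderiv_const_smul_field c) x) _

lemma partialDeriv_pow_two (hf : DifferentiableAt ℝ f x) (i : Fin 4) :
    partialDeriv i (fun x => f x ^ 2) x = 2 * f x * partialDeriv i f x := by
  simp only [pow_two, partialDeriv_mul hf hf]
  ring

lemma partialDeriv_inv (hf : DifferentiableAt ℝ f x) (h0 : f x ≠ 0) (i : Fin 4) :
    partialDeriv i (fun x => (f x)⁻¹) x = -partialDeriv i f x / f x ^ 2 := by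
  have h := ((hasDerivAt_inv h0).comp_hasFDerivAt x hf.hasFDerivAt).fderiv
  simp only [Function.comp_def] at h
  simp [partialDeriv, h, div_eq_inv_mul]

lemma partialDeriv_sqrt (hf : DifferentiableAt ℝ f x) (h0 : f x ≠ 0) (i : Fin 4) :
    partialDeriv i (fun x => √(f x)) x = partialDeriv i f x / (2 * √(f x)) := by
  simp only [partialDeriv, (hf.hasFDerivAt.sqrt h0).fderiv, smul_apply, smul_eq_mul]
  ring

lemma partialDeriv_sum {ι : Type*} {s : Finset ι} {f : ι → E4 → ℝ}
    (hf : ∀ k ∈ s, DifferentiableAt ℝ (f k) x) (i : Fin 4) :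
    partialDeriv i (fun x => ∑ k ∈ s, f k x) x = ∑ k ∈ s, partialDeriv i (f k) x := by
  simp [partialDeriv, fderiv_fun_sum hf]

lemma partialDeriv_coord (i j : Fin 4) :
    partialDeriv i (fun x => x j) x = if j = i then 1 else 0 := by
  have h : HasFDerivAt (fun y : E4 => y j) (EuclideanSpace.proj (𝕜 := ℝ) j) x :=
    (EuclideanSpace.proj (𝕜 := ℝ) j).hasFDerivAt
  simp [partialDeriv, h.fderiv]

lemma fderiv_fderiv_apply_comm {E : Type*} [NormedAddCommGroup E] [NormedSpace ℝ E] {f : E → ℝ}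
    {p : E} (hf : ContDiffAt ℝ 2 f p) (v w : E) :
    fderiv ℝ (fun q => fderiv ℝ f q v) p w = fderiv ℝ (fun q => fderiv ℝ f q w) p v := by
  have hdiff : DifferentiableAt ℝ (fderiv ℝ f) p :=
    (hf.fderiv_right (m := 1) (by norm_num)).differentiableAt (by norm_num)
  have apply_eq : ∀ u, fderiv ℝ (fun q => fderiv ℝ f q u) p = (fderiv ℝ (fderiv ℝ f) p).flip u :=
    fun u => by simpa using (hdiff.hasFDerivAt.clm_apply (hasFDerivAt_const u p)).fderiv
  rw [apply_eq, apply_eq]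
  exact hf.isSymmSndFDerivAt (by simp) w v

lemma partialDeriv_comm (hf : ContDiffAt ℝ 2 f x) (i j : Fin 4) :
    partialDeriv i (partialDeriv j f) x = partialDeriv j (partialDeriv i f) x :=
  fderiv_fderiv_apply_comm hf _ _

lemma contDiffOn_partialDeriv {U : Set E4} (hU : IsOpen U) (hf : ContDiffOn ℝ ∞ f U) (i : Fin 4) :
    ContDiffOn ℝ ∞ (partialDeriv i f) U :=
  (hf.fderiv_of_isOpen hU (by simp)).clm_apply contDiffOn_const

/-- The entrywise partial derivative `∂ᵢ A` of a matrix-valued function of the position. -/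
def matrixDeriv (i : Fin 4) (A : E4 → Matrix (Fin 4) (Fin 4) ℝ) (x : E4) :
    Matrix (Fin 4) (Fin 4) ℝ :=
  Matrix.of fun m n => partialDeriv i (fun x => A x m n) x

/-- The entrywise partial derivative `∂ᵢ b` of a covector-valued function of the position. -/
def covectorDeriv (i : Fin 4) (b : E4 → Fin 4 → ℝ) (x : E4) : Fin 4 → ℝ :=
  fun m => partialDeriv i (fun x => b x m) x

variable {A B : E4 → Matrix (Fin 4) (Fin 4) ℝ} {b c : E4 → Fin 4 → ℝ}

lemma covectorDeriv_const (v : Fin 4 → ℝ) (i : Fin 4) : covectorDeriv i (fun _ => v) x = 0 :=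
  funext fun _ => partialDeriv_const _ i

lemma covectorDeriv_coord (i : Fin 4) : covectorDeriv i (fun y => ⇑y) x = Pi.single i 1 := by
  ext m
  rw [covectorDeriv, partialDeriv_coord, Pi.single_apply]

lemma matrixDeriv_congr (h : A =ᶠ[𝓝 x] B) (i : Fin 4) : matrixDeriv i A x = matrixDeriv i B x := by
  ext m n
  exact partialDeriv_congr (h.mono fun _ h => congrFun₂ h m n) i

lemma covectorDeriv_congr (h : b =ᶠ[𝓝 x] c) (i : Fin 4) :
    covectorDeriv i b x = covectorDeriv i c x := by
  ext m
  exact partialDeriv_congr (h.mono fun _ h => congrFun h m) i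

lemma matrixDeriv_add (hA : ∀ m n, DifferentiableAt ℝ (fun x => A x m n) x)
    (hB : ∀ m n, DifferentiableAt ℝ (fun x => B x m n) x) (i : Fin 4) :
    matrixDeriv i (fun x => A x + B x) x = matrixDeriv i A x + matrixDeriv i B x := by
  ext m n
  exact partialDeriv_add (hA m n) (hB m n) i

lemma differentiableAt_dotProduct (hb : ∀ m, DifferentiableAt ℝ (fun x => b x m) x)
    (hc : ∀ m, DifferentiableAt ℝ (fun x => c x m) x) :
    DifferentiableAt ℝ (fun x => b x ⬝ᵥ c x) x :=
  DifferentiableAt.fun_sum fun k _ => (hb k).fun_mul (hc k)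

lemma partialDeriv_dotProduct (hb : ∀ m, DifferentiableAt ℝ (fun x => b x m) x)
    (hc : ∀ m, DifferentiableAt ℝ (fun x => c x m) x) (i : Fin 4) :
    partialDeriv i (fun x => b x ⬝ᵥ c x) x =
      covectorDeriv i b x ⬝ᵥ c x + b x ⬝ᵥ covectorDeriv i c x := by
  simp only [dotProduct, covectorDeriv, ← Finset.sum_add_distrib]
  rw [partialDeriv_sum fun k _ => (hb k).fun_mul (hc k)]
  exact Finset.sum_congr rfl fun k _ => partialDeriv_mul (hb k) (hc k) i

lemma differentiableAt_matrix_mul (hA : ∀ m n, DifferentiableAt ℝ (fun x => A x m n) x)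
    (hB : ∀ m n, DifferentiableAt ℝ (fun x => B x m n) x) (m n : Fin 4) :
    DifferentiableAt ℝ (fun x => (A x * B x) m n) x :=
  differentiableAt_dotProduct (b := fun x => A x m) (c := fun x k => B x k n) (hA m)
    fun k => hB k n

lemma matrixDeriv_mul (hA : ∀ m n, DifferentiableAt ℝ (fun x => A x m n) x)
    (hB : ∀ m n, DifferentiableAt ℝ (fun x => B x m n) x) (i : Fin 4) :
    matrixDeriv i (fun x => A x * B x) x = matrixDeriv i A x * B x + A x * matrixDeriv i B x := by
  ext m n
  exact partialDeriv_dotProduct (b := fun x => A x m) (c := fun x k => B x k n) (hA m)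
    (fun k => hB k n) i

lemma covectorDeriv_vecMul (hb : ∀ m, DifferentiableAt ℝ (fun x => b x m) x)
    (hA : ∀ m n, DifferentiableAt ℝ (fun x => A x m n) x) (i : Fin 4) :
    covectorDeriv i (fun x => b x ᵥ* A x) x =
      covectorDeriv i b x ᵥ* A x + b x ᵥ* matrixDeriv i A x := by
  ext n
  exact partialDeriv_dotProduct (c := fun x k => A x k n) hb (fun k => hA k n) i

lemma differentiableAt_dotProduct_const (hb : ∀ m, DifferentiableAt ℝ (fun x => b x m) x)
    (v : Fin 4 → ℝ) : DifferentiableAt ℝ (fun x => b x ⬝ᵥ v) x :=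
  differentiableAt_dotProduct (c := fun _ => v) hb fun _ => differentiableAt_const _

lemma partialDeriv_dotProduct_const (hb : ∀ m, DifferentiableAt ℝ (fun x => b x m) x)
    (v : Fin 4 → ℝ) (i : Fin 4) :
    partialDeriv i (fun x => b x ⬝ᵥ v) x = covectorDeriv i b x ⬝ᵥ v := by
  rw [partialDeriv_dotProduct (c := fun _ => v) hb fun _ => differentiableAt_const _,
    covectorDeriv_const, dotProduct_zero, add_zero]

lemma covectorDeriv_mulVec_const (hA : ∀ m n, DifferentiableAt ℝ (fun x => A x m n) x)
    (v : Fin 4 → ℝ) (i : Fin 4) :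
    covectorDeriv i (fun x => A x *ᵥ v) x = matrixDeriv i A x *ᵥ v :=
  funext fun m => partialDeriv_dotProduct_const (hA m) v i

lemma differentiableAt_coord (m : Fin 4) : DifferentiableAt ℝ (fun y : E4 => y m) x := by fun_prop

lemma partialDeriv_dotProduct_coord (v : Fin 4 → ℝ) (i : Fin 4) :
    partialDeriv i (fun y => v ⬝ᵥ ⇑y) x = v i := by
  rw [partialDeriv_dotProduct (b := fun _ => v) (fun _ => differentiableAt_const _)
    differentiableAt_coord, covectorDeriv_const, zero_dotProduct, zero_add, covectorDeriv_coord,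
    dotProduct_single_one]

lemma differentiableAt_dotProduct_coord (v : Fin 4 → ℝ) :
    DifferentiableAt ℝ (fun y : E4 => v ⬝ᵥ ⇑y) x :=
  differentiableAt_dotProduct (fun _ => differentiableAt_const _) differentiableAt_coord

lemma covectorDeriv_mulVec_coord (S : Matrix (Fin 4) (Fin 4) ℝ) (i : Fin 4) :
    covectorDeriv i (fun y => S *ᵥ ⇑y) x = Sᵀ i :=
  funext fun m => partialDeriv_dotProduct_coord (S m) i

lemma differentiableAt_dotProduct_mulVec_self (S : Matrix (Fin 4) (Fin 4) ℝ) :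
    DifferentiableAt ℝ (fun y : E4 => ⇑y ⬝ᵥ S *ᵥ ⇑y) x :=
  differentiableAt_dotProduct differentiableAt_coord fun m =>
    differentiableAt_dotProduct_coord (S m)

lemma partialDeriv_dotProduct_mulVec_self {S : Matrix (Fin 4) (Fin 4) ℝ} (hS : S.IsSymm)
    (i : Fin 4) : partialDeriv i (fun y => ⇑y ⬝ᵥ S *ᵥ ⇑y) x = 2 * (S *ᵥ ⇑x) i := by
  rw [partialDeriv_dotProduct (c := fun y => S *ᵥ ⇑y) differentiableAt_coord fun m =>
    differentiableAt_dotProduct_coord (S m), covectorDeriv_coord, covectorDeriv_mulVec_coord,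
    hS.eq, single_one_dotProduct, dotProduct_comm]
  exact (two_mul _).symm

end PartialDeriv

/-- Smoothness of a function of the bundle coordinates on a set `V` of pairs `(x, y)`. -/
abbrev SmoothOn (V : Set (E4 × E4)) (f : LocalFun) : Prop :=
  ContDiffOn ℝ ∞ (fun p : E4 × E4 => f p.1 p.2) V

section SmoothOn

variable {V : Set (E4 × E4)} {f g : LocalFun} {x y : E4}

lemma eventually_mem_left (hV : IsOpen V) (h : (x, y) ∈ V) : ∀ᶠ x' in 𝓝 x, (x', y) ∈ V :=
  (Continuous.prodMk_left y).continuousAt.eventually_mem (hV.mem_nhds h)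

lemma eventually_mem_right (hV : IsOpen V) (h : (x, y) ∈ V) : ∀ᶠ y' in 𝓝 y, (x, y') ∈ V :=
  (Continuous.prodMk_right x).continuousAt.eventually_mem (hV.mem_nhds h)

lemma dx_congr (hV : IsOpen V) (hfg : ∀ {x y}, (x, y) ∈ V → f x y = g x y) (h : (x, y) ∈ V)
    (i : Fin 4) : dx i f x y = dx i g x y :=
  partialDeriv_congr ((eventually_mem_left hV h).mono fun _ h => hfg h) i

lemma dy_congr (hV : IsOpen V) (hfg : ∀ {x y}, (x, y) ∈ V → f x y = g x y) (h : (x, y) ∈ V)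
    (i : Fin 4) : dy i f x y = dy i g x y :=
  partialDeriv_congr ((eventually_mem_right hV h).mono fun _ h => hfg h) i

lemma dy_sum_coord_mul {f : Fin 4 → LocalFun} (hf : ∀ k, DifferentiableAt ℝ (f k x) y)
    (i : Fin 4) :
    dy i (fun x y => ∑ k, y k * f k x y) x y = f i x y + ∑ k, y k * dy i (f k) x y := by
  have h := partialDeriv_dotProduct (b := fun y => ⇑y) (c := fun y k => f k x y) (x := y)
    differentiableAt_coord hf i
  rwa [covectorDeriv_coord, single_one_dotProduct] at h

lemma dx_sum_coord_mul {f : Fin 4 → LocalFun} (hf : ∀ k, DifferentiableAt ℝ (fun x => f k x y) x)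
    (i : Fin 4) : dx i (fun x y => ∑ k, y k * f k x y) x y = ∑ k, y k * dx i (f k) x y := by
  have h := partialDeriv_dotProduct (b := fun _ => ⇑y) (c := fun x k => f k x y) (x := x)
    (fun _ => differentiableAt_const _) hf i
  rwa [covectorDeriv_const, zero_dotProduct, zero_add] at h

namespace SmoothOn

lemma contDiffAt_right (hf : SmoothOn V f) (hV : IsOpen V) (h : (x, y) ∈ V) :
    ContDiffAt ℝ ∞ (f x) y :=
  ContDiffAt.comp (g := fun p : E4 × E4 => f p.1 p.2) y (hf.contDiffAt (hV.mem_nhds h))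
    (f := fun y' => (x, y')) (by fun_prop)

lemma differentiableAt (hf : SmoothOn V f) (hV : IsOpen V) (h : (x, y) ∈ V) :
    DifferentiableAt ℝ (fun p : E4 × E4 => f p.1 p.2) (x, y) :=
  (hf.contDiffAt (hV.mem_nhds h)).differentiableAt (by simp)

lemma differentiableAt_left (hf : SmoothOn V f) (hV : IsOpen V) (h : (x, y) ∈ V) :
    DifferentiableAt ℝ (fun x' => f x' y) x :=
  DifferentiableAt.comp (g := fun p : E4 × E4 => f p.1 p.2) x (hf.differentiableAt hV h)
    (f := fun x' => (x', y)) (by fun_prop)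

lemma differentiableAt_right (hf : SmoothOn V f) (hV : IsOpen V) (h : (x, y) ∈ V) :
    DifferentiableAt ℝ (f x) y :=
  (hf.contDiffAt_right hV h).differentiableAt (by simp)

lemma dx_eq_fderiv (hf : SmoothOn V f) (hV : IsOpen V) (h : (x, y) ∈ V) (i : Fin 4) :
    dx i f x y =
      fderiv ℝ (fun p : E4 × E4 => f p.1 p.2) (x, y) (EuclideanSpace.single i 1, 0) := by
  have hcomp : HasFDerivAt (fun x' => f x' y) _ x :=
    HasFDerivAt.comp (g := fun p : E4 × E4 => f p.1 p.2) (f := fun x' => (x', y)) x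
      (hf.differentiableAt hV h).hasFDerivAt
      ((hasFDerivAt_id x).prodMk (hasFDerivAt_const y x))
  simp [dx, hcomp.fderiv]

lemma dy_eq_fderiv (hf : SmoothOn V f) (hV : IsOpen V) (h : (x, y) ∈ V) (i : Fin 4) :
    dy i f x y =
      fderiv ℝ (fun p : E4 × E4 => f p.1 p.2) (x, y) (0, EuclideanSpace.single i 1) := by
  have hcomp : HasFDerivAt (f x) _ y :=
    HasFDerivAt.comp (g := fun p : E4 × E4 => f p.1 p.2) (f := fun y' => (x, y')) y
      (hf.differentiableAt hV h).hasFDerivAt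
      ((hasFDerivAt_const x y).prodMk (hasFDerivAt_id y))
  simp [dy, hcomp.fderiv]

protected lemma dx (hf : SmoothOn V f) (hV : IsOpen V) (i : Fin 4) : SmoothOn V (dx i f) :=
  ((hf.fderiv_of_isOpen (m := ∞) hV (by simp)).clm_apply contDiffOn_const).congr
    fun _ hp => hf.dx_eq_fderiv hV hp i

protected lemma dy (hf : SmoothOn V f) (hV : IsOpen V) (i : Fin 4) : SmoothOn V (dy i f) :=
  ((hf.fderiv_of_isOpen (m := ∞) hV (by simp)).clm_apply contDiffOn_const).congr
    fun _ hp => hf.dy_eq_fderiv hV hp i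

lemma dy_dy_comm (hf : SmoothOn V f) (hV : IsOpen V) (h : (x, y) ∈ V) (i j : Fin 4) :
    dy i (dy j f) x y = dy j (dy i f) x y :=
  partialDeriv_comm ((hf.contDiffAt_right hV h).of_le two_le_infty) i j

lemma dx_dy_comm (hf : SmoothOn V f) (hV : IsOpen V) (h : (x, y) ∈ V) (i j : Fin 4) :
    dx i (dy j f) x y = dy j (dx i f) x y := by
  have hdy : (fun p : E4 × E4 => dy j f p.1 p.2) =ᶠ[𝓝 (x, y)] _ :=
    Filter.eventuallyEq_of_mem (hV.mem_nhds h) fun _ hp => hf.dy_eq_fderiv hV hp j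
  have hdx : (fun p : E4 × E4 => dx i f p.1 p.2) =ᶠ[𝓝 (x, y)] _ :=
    Filter.eventuallyEq_of_mem (hV.mem_nhds h) fun _ hp => hf.dx_eq_fderiv hV hp i
  rw [(hf.dy hV j).dx_eq_fderiv hV h, (hf.dx hV i).dy_eq_fderiv hV h, hdy.fderiv_eq, hdx.fderiv_eq]
  exact fderiv_fderiv_apply_comm ((hf.contDiffAt (hV.mem_nhds h)).of_le two_le_infty) _ _

end SmoothOn

end SmoothOn

/-- `V` is an open set of bundle coordinates `(x, y)` on which `F` is a Finsler function: smooth,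
positively homogeneous of degree one in `y` and with non-degenerate fundamental tensor. -/
structure IsFinslerChart (V : Set (E4 × E4)) (F : LocalFun) : Prop where
  isOpen : IsOpen V
  smooth : SmoothOn V F
  homogeneous : ∀ {x y} {c : ℝ}, (x, y) ∈ V → 0 < c → F x (c • y) = c * F x y
  det_ne_zero : ∀ {x y}, (x, y) ∈ V → (fundamentalTensor F x y).det ≠ 0

/-- The covector `yˡ ∂ₗ ∂̄ₖ F² - ∂ₖ F²` of the geodesic equation. -/
def sprayCovector (F : LocalFun) (k : Fin 4) : LocalFun := fun x y =>
  (∑ l, y l * dx l (dy k (fun x y => F x y ^ 2)) x y) - dx k (fun x y => F x y ^ 2) x y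

/-- The geodesic spray coefficients `gⁱᵏ (yˡ ∂ₗ ∂̄ₖ F² - ∂ₖ F²)`, four times the potential of the
Cartan non-linear connection. -/
def spray (F : LocalFun) (i : Fin 4) : LocalFun :=
  fun x y => ((fundamentalTensor F x y)⁻¹ *ᵥ fun k => sprayCovector F k x y) i

section Finsler

variable {V : Set (E4 × E4)} {F : LocalFun} {x y : E4}

lemma fundamentalTensor_apply (i j : Fin 4) :
    fundamentalTensor F x y i j = 1 / 2 * dy i (dy j fun x y => F x y ^ 2) x y := by
  have inner : dy j (fun x y => 1 / 2 * F x y ^ 2) =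
      fun x y => 1 / 2 * dy j (fun x y => F x y ^ 2) x y :=
    funext₂ fun _ _ => partialDeriv_const_mul _ _ _
  rw [fundamentalTensor, Matrix.of_apply, inner]
  exact partialDeriv_const_mul _ _ _

lemma cartanConnection_eq (i j : Fin 4) :
    cartanConnection F i j x y = 1 / 4 * dy j (spray F i) x y := rfl

lemma sum_mul_dy_eq_of_homogeneous {f : LocalFun} {n : ℕ} (hf : DifferentiableAt ℝ (f x) y)
    (hhom : ∀ c : ℝ, 0 < c → f x (c • y) = c ^ n * f x y) :
    ∑ i, y i * dy i f x y = n * f x y := by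
  have radial : HasDerivAt (fun c : ℝ => f x (c • y)) (fderiv ℝ (f x) y y) 1 := by
    have hline : HasDerivAt (fun c : ℝ => c • y) y 1 := by
      simpa using (hasDerivAt_id (1 : ℝ)).smul_const y
    have hf' : HasFDerivAt (f x) (fderiv ℝ (f x) y) ((1 : ℝ) • y) := by
      simpa using hf.hasFDerivAt
    exact hf'.comp_hasDerivAt 1 hline
  have power : HasDerivAt (fun c : ℝ => f x (c • y)) (n * f x y) 1 := by
    have hpow : HasDerivAt (fun c : ℝ => c ^ n * f x y) (n * f x y) 1 := by
      simpa using (hasDerivAt_pow n (1 : ℝ)).mul_const (f x y)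
    exact hpow.congr_of_eventuallyEq ((lt_mem_nhds one_pos).mono fun c hc => hhom c hc)
  have expand := congrArg (fderiv ℝ (f x) y) ((EuclideanSpace.basisFun (Fin 4) ℝ).sum_repr y)
  simp only [map_sum, map_smul, smul_eq_mul, EuclideanSpace.basisFun_apply,
    EuclideanSpace.basisFun_repr] at expand
  exact expand.trans (radial.unique power)

namespace IsFinslerChart

variable (hF : IsFinslerChart V F) (h : (x, y) ∈ V)
include hF

lemma smooth_sq : SmoothOn V fun x y => F x y ^ 2 := hF.smooth.pow 2

lemma smooth_dy_sq (i : Fin 4) : SmoothOn V (dy i fun x y => F x y ^ 2) :=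
  hF.smooth_sq.dy hF.isOpen i

lemma smooth_sprayCovector (k : Fin 4) : SmoothOn V (sprayCovector F k) :=
  (ContDiffOn.sum fun l _ => ContDiffOn.mul (by fun_prop) ((hF.smooth_dy_sq k).dx hF.isOpen l)).sub
    (hF.smooth_sq.dx hF.isOpen k)

lemma smooth_spray (i : Fin 4) : SmoothOn V (spray F i) := by
  have hg (i j : Fin 4) :
      ContDiffOn ℝ ∞ (fun p : E4 × E4 => fundamentalTensor F p.1 p.2 i j) V := by
    simp only [fundamentalTensor_apply]
    exact contDiffOn_const.mul ((hF.smooth_dy_sq j).dy hF.isOpen i)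
  unfold SmoothOn spray Matrix.mulVec dotProduct
  exact ContDiffOn.sum fun k _ =>
    (contDiffOn_inv_apply (A := fun p : E4 × E4 => fundamentalTensor F p.1 p.2) hg
      (fun _ hp => hF.det_ne_zero hp) i k).mul (hF.smooth_sprayCovector k)

include h

lemma isSymm_fundamentalTensor : (fundamentalTensor F x y).IsSymm :=
  Matrix.IsSymm.ext fun i j => by
    rw [fundamentalTensor_apply, fundamentalTensor_apply, hF.smooth_sq.dy_dy_comm hF.isOpen h]

lemma fundamentalTensor_mulVec_spray :
    (fundamentalTensor F x y *ᵥ fun i => spray F i x y) = fun k => sprayCovector F k x y := by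
  change _ *ᵥ (_ *ᵥ _) = _
  rw [Matrix.mulVec_mulVec, Matrix.mul_nonsing_inv _ (hF.det_ne_zero h).isUnit, Matrix.one_mulVec]

lemma sum_mul_dy_sq : ∑ k, y k * dy k (fun x y => F x y ^ 2) x y = 2 * F x y ^ 2 := by
  exact_mod_cast sum_mul_dy_eq_of_homogeneous (f := fun x y => F x y ^ 2) (n := 2)
    (hF.smooth_sq.differentiableAt_right hF.isOpen h)
    fun c hc => by simp only [hF.homogeneous h hc, mul_pow]

lemma fundamentalTensor_mulVec_self (i : Fin 4) :
    (fundamentalTensor F x y *ᵥ ⇑y) i = 1 / 2 * dy i (fun x y => F x y ^ 2) x y := by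
  have deriv_euler : dy i (fun x y => ∑ k, y k * dy k (fun x y => F x y ^ 2) x y) x y =
      2 * dy i (fun x y => F x y ^ 2) x y :=
    (dy_congr hF.isOpen hF.sum_mul_dy_sq h i).trans (partialDeriv_const_mul _ _ _)
  rw [dy_sum_coord_mul fun k => (hF.smooth_dy_sq k).differentiableAt_right hF.isOpen h]
    at deriv_euler
  simp only [Matrix.mulVec, dotProduct, fundamentalTensor_apply, mul_assoc, ← Finset.mul_sum]
  simp only [mul_comm _ (y _)]
  linarith

lemma sum_mul_sprayCovector :
    ∑ k, y k * sprayCovector F k x y = ∑ l, y l * dx l (fun x y => F x y ^ 2) x y := by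
  have dx_euler (l : Fin 4) : ∑ k, y k * dx l (dy k fun x y => F x y ^ 2) x y =
      2 * dx l (fun x y => F x y ^ 2) x y := by
    rw [← dx_sum_coord_mul fun k => (hF.smooth_dy_sq k).differentiableAt_left hF.isOpen h]
    exact (dx_congr hF.isOpen hF.sum_mul_dy_sq h l).trans (partialDeriv_const_mul _ _ _)
  simp only [sprayCovector, mul_sub, Finset.sum_sub_distrib, Finset.mul_sum]
  rw [Finset.sum_comm]
  simp only [mul_left_comm (y _) (y _), ← Finset.mul_sum, dx_euler]
  rw [← Finset.sum_sub_distrib]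
  exact Finset.sum_congr rfl fun l _ => by ring

lemma sum_spray_mul_dy_sq :
    ∑ i, spray F i x y * dy i (fun x y => F x y ^ 2) x y =
      2 * ∑ l, y l * dx l (fun x y => F x y ^ 2) x y := by
  have pairing := dotProduct_mulVec_comm (hF.isSymm_fundamentalTensor h)
    (fun i => spray F i x y) ⇑y
  rw [hF.fundamentalTensor_mulVec_spray h] at pairing
  simp only [dotProduct, hF.fundamentalTensor_mulVec_self h, hF.sum_mul_sprayCovector h,
    mul_left_comm _ (1 / 2 : ℝ), ← Finset.mul_sum] at pairing
  linarith

-- Differentiate `sum_spray_mul_dy_sq` along `∂̄ⱼ` and cancel the terms containing the spray.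
lemma sum_cartanConnection_mul_dy_sq (j : Fin 4) :
    ∑ i, cartanConnection F i j x y * dy i (fun x y => F x y ^ 2) x y =
      dx j (fun x y => F x y ^ 2) x y := by
  have deriv_pairing : dy j (fun x y => ∑ i, spray F i x y * dy i (fun x y => F x y ^ 2) x y) x y =
      2 * dy j (fun x y => ∑ l, y l * dx l (fun x y => F x y ^ 2) x y) x y :=
    (dy_congr hF.isOpen hF.sum_spray_mul_dy_sq h j).trans (partialDeriv_const_mul _ _ _)
  have product_rule := partialDeriv_dotProduct (x := y)
    (fun i => (hF.smooth_spray i).differentiableAt_right hF.isOpen h)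
    (fun i => (hF.smooth_dy_sq i).differentiableAt_right hF.isOpen h) j
  have spray_term : ∑ i, spray F i x y * dy j (dy i fun x y => F x y ^ 2) x y =
      2 * sprayCovector F j x y := by
    rw [← congrFun (hF.fundamentalTensor_mulVec_spray h) j]
    simp only [Matrix.mulVec, dotProduct, fundamentalTensor_apply, Finset.mul_sum]
    exact Finset.sum_congr rfl fun i _ => by ring
  rw [dy_sum_coord_mul fun l => (hF.smooth_sq.dx hF.isOpen l).differentiableAt_right hF.isOpen h]
    at deriv_pairing
  simp only [← hF.smooth_sq.dx_dy_comm hF.isOpen h] at deriv_pairing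
  simp only [cartanConnection_eq, mul_assoc, ← Finset.mul_sum]
  change dy j (fun x y => ∑ i, spray F i x y * dy i (fun x y => F x y ^ 2) x y) x y =
    ∑ i, dy j (spray F i) x y * dy i (fun x y => F x y ^ 2) x y +
    ∑ i, spray F i x y * dy j (dy i fun x y => F x y ^ 2) x y at product_rule
  rw [spray_term, sprayCovector] at product_rule
  linarith

lemma dx_sq (j : Fin 4) : dx j (fun x y => F x y ^ 2) x y = 2 * F x y * dx j F x y :=
  partialDeriv_pow_two (hF.smooth.differentiableAt_left hF.isOpen h) j

lemma dy_sq (j : Fin 4) : dy j (fun x y => F x y ^ 2) x y = 2 * F x y * dy j F x y :=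
  partialDeriv_pow_two (hF.smooth.differentiableAt_right hF.isOpen h) j

lemma fundamentalTensor_eq_dy_dy (i j : Fin 4) : fundamentalTensor F x y i j =
    F x y * dy i (dy j F) x y + dy i F x y * dy j F x y := by
  rw [fundamentalTensor_apply, dy_congr hF.isOpen (fun h => hF.dy_sq h j) h]
  simp only [mul_assoc]
  have product_rule : dy i (fun x y => F x y * dy j F x y) x y = _ :=
    partialDeriv_mul (hF.smooth.differentiableAt_right hF.isOpen h)
      ((hF.smooth.dy hF.isOpen j).differentiableAt_right hF.isOpen h) i
  have const_mul : dy i (fun x y => 2 * (F x y * dy j F x y)) x y = _ :=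
    partialDeriv_const_mul _ _ _
  rw [const_mul]
  change 1 / 2 * (2 * dy i (fun x y => F x y * dy j F x y) x y) = _
  rw [product_rule]
  change 1 / 2 * (2 * (dy i F x y * dy j F x y + F x y * dy i (dy j F) x y)) = _
  ring

-- Where `F = 0` the fundamental tensor has rank at most one.
lemma ne_zero : F x y ≠ 0 := by
  intro h0
  apply hF.det_ne_zero h
  have rank_one : fundamentalTensor F x y =
      Matrix.vecMulVec (fun i => dy i F x y) (fun j => dy j F x y) := by
    ext i j
    rw [hF.fundamentalTensor_eq_dy_dy h, h0, zero_mul, zero_add, Matrix.vecMulVec_apply]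
  rw [rank_one, Matrix.det_vecMulVec]

lemma sum_cartanConnection_mul_dy (j : Fin 4) :
    ∑ i, cartanConnection F i j x y * dy i F x y = dx j F x y := by
  have hsq := hF.sum_cartanConnection_mul_dy_sq h j
  simp only [hF.dx_sq h, hF.dy_sq h, mul_left_comm _ (2 * F x y), ← Finset.mul_sum] at hsq
  exact mul_left_cancel₀ (mul_ne_zero two_ne_zero (hF.ne_zero h)) hsq

lemma dy_cartanConnection_comm (i j k : Fin 4) :
    dy k (cartanConnection F i j) x y = dy j (cartanConnection F i k) x y := by
  have const_mul (j k : Fin 4) :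
      dy k (cartanConnection F i j) x y = 1 / 4 * dy k (dy j (spray F i)) x y :=
    partialDeriv_const_mul _ _ _
  rw [const_mul, const_mul, (hF.smooth_spray i).dy_dy_comm hF.isOpen h]

end IsFinslerChart

end Finsler

section LinearConnection

variable {Γ : Fin 4 → E4 → Matrix (Fin 4) (Fin 4) ℝ} {a : E4 → Matrix (Fin 4) (Fin 4) ℝ}
  {b : E4 → Fin 4 → ℝ} {x : E4}

lemma matrixDeriv_comm (ha : ∀ m n, ContDiffAt ℝ 2 (fun x => a x m n) x) (i j : Fin 4) :
    matrixDeriv i (matrixDeriv j a) x = matrixDeriv j (matrixDeriv i a) x := by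
  ext m n
  exact partialDeriv_comm (ha m n) i j

lemma covectorDeriv_comm (hb : ∀ m, ContDiffAt ℝ 2 (fun x => b x m) x) (i j : Fin 4) :
    covectorDeriv i (covectorDeriv j b) x = covectorDeriv j (covectorDeriv i b) x := by
  ext m
  exact partialDeriv_comm (hb m) i j

/-- The curvature `∂ⱼ Γₖ - ∂ₖ Γⱼ + [Γⱼ, Γₖ]` of the linear connection with connection matrices
`(Γⱼ)ⁱₖ = Γⁱⱼₖ`. -/
def linearCurvature (Γ : Fin 4 → E4 → Matrix (Fin 4) (Fin 4) ℝ) (j k : Fin 4) (x : E4) :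
    Matrix (Fin 4) (Fin 4) ℝ :=
  matrixDeriv j (Γ k) x - matrixDeriv k (Γ j) x + (Γ j x * Γ k x - Γ k x * Γ j x)

/-- The Ricci tensor `R_lk = R_lⁱᵢₖ` of the linear connection with connection matrices `Γⱼ`. -/
def linearRicci (Γ : Fin 4 → E4 → Matrix (Fin 4) (Fin 4) ℝ) (x : E4) :
    Matrix (Fin 4) (Fin 4) ℝ :=
  Matrix.of fun l k => ∑ i, linearCurvature Γ i k x i l

/-- The components of the covariant derivative `∇ⱼ b` of the covector field `b`. -/
def covectorCovDeriv (Γ : Fin 4 → E4 → Matrix (Fin 4) (Fin 4) ℝ) (j : Fin 4) (b : E4 → Fin 4 → ℝ)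
    (x : E4) : Fin 4 → ℝ :=
  covectorDeriv j b x - b x ᵥ* Γ j x

/-- The components of the covariant derivative `∇ⱼ a` of the `(0,2)`-tensor field `a`. -/
def tensorCovDeriv (Γ : Fin 4 → E4 → Matrix (Fin 4) (Fin 4) ℝ) (j : Fin 4)
    (a : E4 → Matrix (Fin 4) (Fin 4) ℝ) (x : E4) : Matrix (Fin 4) (Fin 4) ℝ :=
  matrixDeriv j a x - ((Γ j x)ᵀ * a x + a x * Γ j x)

-- The second derivatives of a parallel field commute, whatever the connection.
lemma vecMul_linearCurvature_eq_zero (hb : ∀ m, ContDiffAt ℝ 2 (fun x => b x m) x)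
    (hΓ : ∀ j m n, DifferentiableAt ℝ (fun x => Γ j x m n) x)
    (hparallel : ∀ᶠ x in 𝓝 x, ∀ j, covectorCovDeriv Γ j b x = 0) (j k : Fin 4) :
    b x ᵥ* linearCurvature Γ j k x = 0 := by
  have second_deriv (j k : Fin 4) : covectorDeriv j (covectorDeriv k b) x =
      b x ᵥ* (Γ j x * Γ k x) + b x ᵥ* matrixDeriv j (Γ k) x := by
    rw [covectorDeriv_congr (hparallel.mono fun _ h => sub_eq_zero.1 (h k)) j,
      covectorDeriv_vecMul (fun m => (hb m).differentiableAt two_ne_zero) (hΓ k),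
      sub_eq_zero.1 (hparallel.self_of_nhds j), Matrix.vecMul_vecMul]
  have commute := covectorDeriv_comm hb j k
  rw [second_deriv, second_deriv] at commute
  rw [linearCurvature, Matrix.vecMul_add, Matrix.vecMul_sub, Matrix.vecMul_sub]
  linear_combination (exp := 1) commute

lemma transpose_linearCurvature_mul_add_mul_eq_zero
    (ha : ∀ m n, ContDiffAt ℝ 2 (fun x => a x m n) x)
    (hΓ : ∀ j m n, DifferentiableAt ℝ (fun x => Γ j x m n) x)
    (hcompat : ∀ᶠ x in 𝓝 x, ∀ j, tensorCovDeriv Γ j a x = 0) (j k : Fin 4) :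
    (linearCurvature Γ j k x)ᵀ * a x + a x * linearCurvature Γ j k x = 0 := by
  have ha' : ∀ m n, DifferentiableAt ℝ (fun x => a x m n) x :=
    fun m n => (ha m n).differentiableAt two_ne_zero
  have hΓt (j m n : Fin 4) : DifferentiableAt ℝ (fun x => (Γ j x)ᵀ m n) x := hΓ j n m
  have second_deriv (j k : Fin 4) : matrixDeriv j (matrixDeriv k a) x =
      (matrixDeriv j (Γ k) x)ᵀ * a x + (Γ k x)ᵀ * ((Γ j x)ᵀ * a x + a x * Γ j x) +
        (((Γ j x)ᵀ * a x + a x * Γ j x) * Γ k x + a x * matrixDeriv j (Γ k) x) := by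
    rw [matrixDeriv_congr (hcompat.mono fun _ h => sub_eq_zero.1 (h k)) j,
      matrixDeriv_add (differentiableAt_matrix_mul (hΓt k) ha')
        (differentiableAt_matrix_mul ha' (hΓ k)),
      matrixDeriv_mul (hΓt k) ha', matrixDeriv_mul ha' (hΓ k),
      sub_eq_zero.1 (hcompat.self_of_nhds j)]
    rfl
  have commute := matrixDeriv_comm ha j k
  rw [second_deriv, second_deriv] at commute
  simp only [linearCurvature, Matrix.transpose_add, Matrix.transpose_sub, Matrix.transpose_mul]
  rw [← sub_eq_zero] at commute
  rw [← commute]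
  noncomm_ring

lemma linearCurvature_bianchi (htorsion : ∀ᶠ x in 𝓝 x, ∀ i j k, Γ j x i k = Γ k x i j)
    (i j k l : Fin 4) :
    linearCurvature Γ j k x i l + linearCurvature Γ k l x i j +
      linearCurvature Γ l j x i k = 0 := by
  have deriv_torsion (p i j k : Fin 4) : matrixDeriv p (Γ j) x i k = matrixDeriv p (Γ k) x i j :=
    partialDeriv_congr (htorsion.mono fun _ h => h i j k) p
  have mul_torsion (i j k l : Fin 4) : (Γ j x * Γ k x) i l = (Γ j x * Γ l x) i k := by
    simp only [Matrix.mul_apply, htorsion.self_of_nhds _ k l]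
  simp only [linearCurvature, Matrix.add_apply, Matrix.sub_apply]
  rw [deriv_torsion j i k l, deriv_torsion k i l j, deriv_torsion l i j k, mul_torsion i j k l,
    mul_torsion i k l j, mul_torsion i l j k]
  ring

lemma isSymm_linearRicci (htorsion : ∀ᶠ x in 𝓝 x, ∀ i j k, Γ j x i k = Γ k x i j)
    (htrace : ∀ j k, (linearCurvature Γ j k x).trace = 0) : (linearRicci Γ x).IsSymm := by
  have antisymm (j k : Fin 4) : linearCurvature Γ j k x = -linearCurvature Γ k j x := by
    simp only [linearCurvature]
    noncomm_ring
  refine Matrix.IsSymm.ext fun k l => ?_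
  have contracted : ∑ i, (linearCurvature Γ i k x i l + linearCurvature Γ k l x i i +
      linearCurvature Γ l i x i k) = 0 :=
    Finset.sum_eq_zero fun i _ => linearCurvature_bianchi htorsion i i k l
  have hflip : ∑ i, linearCurvature Γ l i x i k = -linearRicci Γ x k l := by
    simp only [linearRicci, Matrix.of_apply, ← Finset.sum_neg_distrib]
    exact Finset.sum_congr rfl fun i _ => by rw [antisymm, Matrix.neg_apply]
  rw [Finset.sum_add_distrib, Finset.sum_add_distrib, hflip] at contracted
  have htr := htrace k l
  simp only [Matrix.trace, Matrix.diag] at htr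
  simp only [linearRicci, Matrix.of_apply] at contracted ⊢
  linarith

end LinearConnection

/-- `a` is a pseudo-Riemannian metric, of arbitrary signature, on the open set `U` of positions. -/
structure IsMetricChart (U : Set E4) (a : E4 → Matrix (Fin 4) (Fin 4) ℝ) : Prop where
  isOpen : IsOpen U
  smooth : ∀ i j, ContDiffOn ℝ ∞ (fun x => a x i j) U
  isSymm : ∀ {x}, x ∈ U → (a x).IsSymm
  isUnit_det : ∀ {x}, x ∈ U → IsUnit (a x).det

/-- The connection matrices `(Γⱼ)ⁱₖ = Γⁱⱼₖ` of the Levi-Civita connection. -/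
def leviCivita (a : E4 → Matrix (Fin 4) (Fin 4) ℝ) (j : Fin 4) (x : E4) :
    Matrix (Fin 4) (Fin 4) ℝ :=
  Matrix.of fun i k => christoffel a i j k x

/-- The Christoffel symbols of the first kind `Γ_ljk = (1/2) (∂ⱼ a_lk + ∂ₖ a_lj - ∂ₗ a_jk)`. -/
def christoffelFirst (a : E4 → Matrix (Fin 4) (Fin 4) ℝ) (l j k : Fin 4) (x : E4) : ℝ :=
  1 / 2 * (matrixDeriv j a x l k + matrixDeriv k a x l j - matrixDeriv l a x j k)

section Metric

variable {U : Set E4} {a : E4 → Matrix (Fin 4) (Fin 4) ℝ} {b : E4 → Fin 4 → ℝ} {x : E4}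

lemma leviCivita_apply (i j k : Fin 4) :
    leviCivita a j x i k = ∑ l, (a x)⁻¹ i l * christoffelFirst a l j k x := by
  rw [leviCivita, Matrix.of_apply, christoffel, Finset.mul_sum]
  exact Finset.sum_congr rfl fun l _ => mul_left_comm _ _ _

namespace IsMetricChart

variable (ha : IsMetricChart U a)
include ha

lemma contDiffOn_christoffelFirst (l j k : Fin 4) : ContDiffOn ℝ ∞ (christoffelFirst a l j k) U :=
  contDiffOn_const.mul (((contDiffOn_partialDeriv ha.isOpen (ha.smooth l k) j).add
    (contDiffOn_partialDeriv ha.isOpen (ha.smooth l j) k)).sub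
      (contDiffOn_partialDeriv ha.isOpen (ha.smooth j k) l))

lemma contDiffOn_leviCivita (j i k : Fin 4) : ContDiffOn ℝ ∞ (fun x => leviCivita a j x i k) U := by
  simp only [leviCivita_apply]
  exact ContDiffOn.sum fun l _ => (contDiffOn_inv_apply ha.smooth
    (fun _ hx => (ha.isUnit_det hx).ne_zero) i l).mul (ha.contDiffOn_christoffelFirst l j k)

variable (hx : x ∈ U)
include hx

lemma matrixDeriv_apply_comm (i j k : Fin 4) : matrixDeriv i a x j k = matrixDeriv i a x k j :=
  partialDeriv_congr
    (Filter.eventually_of_mem (ha.isOpen.mem_nhds hx) fun _ hx => (ha.isSymm hx).apply k j) i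

lemma differentiableAt (i j : Fin 4) : DifferentiableAt ℝ (fun x => a x i j) x :=
  ((ha.smooth i j).contDiffAt (ha.isOpen.mem_nhds hx)).differentiableAt (by simp)

lemma differentiableAt_leviCivita (j i k : Fin 4) :
    DifferentiableAt ℝ (fun x => leviCivita a j x i k) x :=
  ((ha.contDiffOn_leviCivita j i k).contDiffAt (ha.isOpen.mem_nhds hx)).differentiableAt (by simp)

lemma mul_leviCivita_apply (l j k : Fin 4) :
    (a x * leviCivita a j x) l k = christoffelFirst a l j k x := by
  have raised : leviCivita a j x = (a x)⁻¹ * Matrix.of fun l k => christoffelFirst a l j k x := by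
    ext i k
    exact leviCivita_apply i j k
  rw [raised, Matrix.mul_nonsing_inv_cancel_left _ _ (ha.isUnit_det hx), Matrix.of_apply]

lemma leviCivita_apply_comm (i j k : Fin 4) : leviCivita a j x i k = leviCivita a k x i j := by
  simp only [leviCivita_apply, christoffelFirst, ha.matrixDeriv_apply_comm hx _ j k,
    add_comm (matrixDeriv j a x _ k)]

lemma tensorCovDeriv_leviCivita (j : Fin 4) : tensorCovDeriv (leviCivita a) j a x = 0 := by
  have transposed : (leviCivita a j x)ᵀ * a x = (a x * leviCivita a j x)ᵀ := by
    rw [Matrix.transpose_mul, (ha.isSymm hx).eq]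
  refine sub_eq_zero.2 ?_
  ext m n
  rw [transposed, Matrix.add_apply, Matrix.transpose_apply, ha.mul_leviCivita_apply hx,
    ha.mul_leviCivita_apply hx, christoffelFirst, christoffelFirst,
    ha.matrixDeriv_apply_comm hx j n m, ha.matrixDeriv_apply_comm hx m n j,
    ha.matrixDeriv_apply_comm hx n m j]
  ring

lemma eq_leviCivita_of_torsionFree_of_compatible
    {Γ : Fin 4 → E4 → Matrix (Fin 4) (Fin 4) ℝ} (htorsion : ∀ i j k, Γ j x i k = Γ k x i j)
    (hcompat : ∀ j, tensorCovDeriv Γ j a x = 0) (j : Fin 4) : Γ j x = leviCivita a j x := by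
  have lowered_symm (l j k : Fin 4) : (a x * Γ j x) l k = (a x * Γ k x) l j := by
    simp only [Matrix.mul_apply, htorsion _ j k]
  have deriv_metric (j m n : Fin 4) :
      matrixDeriv j a x m n = (a x * Γ j x) n m + (a x * Γ j x) m n := by
    have transposed : (Γ j x)ᵀ * a x = (a x * Γ j x)ᵀ := by
      rw [Matrix.transpose_mul, (ha.isSymm hx).eq]
    rw [sub_eq_zero.1 (hcompat j), transposed, Matrix.add_apply, Matrix.transpose_apply]
  have lowered : a x * Γ j x = a x * leviCivita a j x := by
    ext l k
    rw [ha.mul_leviCivita_apply hx, christoffelFirst, deriv_metric, deriv_metric, deriv_metric,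
      lowered_symm l k j, lowered_symm k l j, lowered_symm j l k]
    ring
  rw [← Matrix.nonsing_inv_mul_cancel_left (a x) (Γ j x) (ha.isUnit_det hx), lowered,
    Matrix.nonsing_inv_mul_cancel_left _ _ (ha.isUnit_det hx)]

lemma riemannCurvature_eq_linearCurvature (l i j k : Fin 4) :
    riemannCurvature a l i j k x = linearCurvature (leviCivita a) j k x i l := by
  rw [linearCurvature, Matrix.add_apply, Matrix.sub_apply, Matrix.sub_apply, Matrix.mul_apply,
    Matrix.mul_apply, ← Finset.sum_sub_distrib]
  refine congrArg (_ + ·) (Finset.sum_congr rfl fun m _ => ?_)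
  rw [ha.leviCivita_apply_comm hx i j m, ha.leviCivita_apply_comm hx i k m]
  rfl

lemma ricci_eq_linearRicci (l k : Fin 4) :
    ricci a l k x = linearRicci (leviCivita a) x l k :=
  Finset.sum_congr rfl fun i _ => ha.riemannCurvature_eq_linearCurvature hx l i i k

lemma transpose_linearCurvature_leviCivita (j k : Fin 4) :
    (linearCurvature (leviCivita a) j k x)ᵀ * a x + a x * linearCurvature (leviCivita a) j k x =
      0 :=
  transpose_linearCurvature_mul_add_mul_eq_zero
    (fun m n => ((ha.smooth m n).contDiffAt (ha.isOpen.mem_nhds hx)).of_le two_le_infty)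
    (ha.differentiableAt_leviCivita hx)
    (Filter.eventually_of_mem (ha.isOpen.mem_nhds hx) fun _ => ha.tensorCovDeriv_leviCivita) j k

lemma isSymm_linearRicci_leviCivita : (linearRicci (leviCivita a) x).IsSymm :=
  isSymm_linearRicci
    (Filter.eventually_of_mem (ha.isOpen.mem_nhds hx) fun _ => ha.leviCivita_apply_comm)
    fun j k => trace_eq_zero_of_transpose_mul_add_mul_eq_zero (ha.isUnit_det hx)
      (ha.transpose_linearCurvature_leviCivita hx j k)

lemma linearRicci_mulVec_eq_zero_of_parallel (hb : ∀ m, ContDiffAt ℝ 2 (fun x => b x m) x)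
    (hparallel : ∀ᶠ x in 𝓝 x, ∀ j, covectorCovDeriv (leviCivita a) j b x = 0) :
    linearRicci (leviCivita a) x *ᵥ ((a x)⁻¹ *ᵥ b x) = 0 := by
  have curvature_mulVec (j k : Fin 4) :
      linearCurvature (leviCivita a) j k x *ᵥ ((a x)⁻¹ *ᵥ b x) = 0 :=
    mulVec_inv_mulVec_eq_zero (ha.isUnit_det hx) (ha.transpose_linearCurvature_leviCivita hx j k)
      (vecMul_linearCurvature_eq_zero hb (ha.differentiableAt_leviCivita hx) hparallel j k)
  rw [← Matrix.vecMul_transpose, (ha.isSymm_linearRicci_leviCivita hx).eq]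
  ext k
  simp only [Matrix.vecMul, dotProduct, linearRicci, Matrix.of_apply, Finset.mul_sum]
  rw [Finset.sum_comm]
  refine Finset.sum_eq_zero fun i _ => ?_
  rw [← Pi.zero_apply (M := fun _ : Fin 4 => ℝ) i, ← congrFun (curvature_mulVec i k) i]
  exact Finset.sum_congr rfl fun l _ => mul_comm _ _

end IsMetricChart

end Metric

/-- On the set `V` of bundle coordinates, the Cartan non-linear connection of `F` is the linear
connection `Nⁱⱼ = Γⁱⱼₖ(x) yᵏ` with connection matrices `(Γⱼ)ⁱₖ = Γⁱⱼₖ`. -/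
def IsBerwaldOn (V : Set (E4 × E4)) (F : LocalFun)
    (Γ : Fin 4 → E4 → Matrix (Fin 4) (Fin 4) ℝ) : Prop :=
  ∀ x y, (x, y) ∈ V → ∀ i j, cartanConnection F i j x y = (Γ j x *ᵥ ⇑y) i

namespace IsBerwaldOn

variable {V : Set (E4 × E4)} {F : LocalFun} {Γ : Fin 4 → E4 → Matrix (Fin 4) (Fin 4) ℝ} {x y : E4}
  (hV : IsOpen V) (hΓ : IsBerwaldOn V F Γ)
include hV hΓ

lemma dy_cartanConnection (h : (x, y) ∈ V) (i j k : Fin 4) :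
    dy k (cartanConnection F i j) x y = Γ j x i k :=
  (dy_congr hV (fun h => hΓ _ _ h i j) h k).trans (partialDeriv_dotProduct_coord _ k)

lemma dx_cartanConnection (hdiff : ∀ j m n, DifferentiableAt ℝ (fun x => Γ j x m n) x)
    (h : (x, y) ∈ V) (i j k : Fin 4) :
    dx k (cartanConnection F i j) x y = (matrixDeriv k (Γ j) x *ᵥ ⇑y) i :=
  (dx_congr hV (fun h => hΓ _ _ h i j) h k).trans
    (congrFun (covectorDeriv_mulVec_const (hdiff j) ⇑y k) i)

lemma nonlinearCurvature_eq (hdiff : ∀ j m n, DifferentiableAt ℝ (fun x => Γ j x m n) x)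
    (h : (x, y) ∈ V) (i j k : Fin 4) :
    nonlinearCurvature F i j k x y = (linearCurvature Γ j k x *ᵥ ⇑y) i := by
  have horizontal (j k : Fin 4) : horizontalDeriv F j (cartanConnection F i k) x y =
      (matrixDeriv j (Γ k) x *ᵥ ⇑y) i - ((Γ k x * Γ j x) *ᵥ ⇑y) i := by
    simp only [horizontalDeriv, hΓ.dx_cartanConnection hV hdiff h, hΓ.dy_cartanConnection hV h,
      hΓ x y h, ← Matrix.mulVec_mulVec]
    exact congrArg (_ - ·) (dotProduct_comm _ _)
  rw [nonlinearCurvature, horizontal, horizontal, linearCurvature, Matrix.add_mulVec,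
    Matrix.sub_mulVec, Matrix.sub_mulVec]
  simp only [Pi.add_apply, Pi.sub_apply]
  ring

lemma finslerRic_eq (hdiff : ∀ j m n, DifferentiableAt ℝ (fun x => Γ j x m n) x)
    (h : (x, y) ∈ V) : finslerRic F x y = ⇑y ⬝ᵥ linearRicci Γ x *ᵥ ⇑y := by
  simp only [finslerRic, hΓ.nonlinearCurvature_eq hV hdiff h, Matrix.mulVec, dotProduct,
    linearRicci, Matrix.of_apply, Finset.sum_mul, Finset.mul_sum]
  rw [Finset.sum_comm]
  conv_rhs => rw [Finset.sum_comm]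
  refine Finset.sum_congr rfl fun j _ => Finset.sum_comm.trans ?_
  exact Finset.sum_congr rfl fun l _ => Finset.sum_congr rfl fun i _ => by ring

lemma finslerRicci_eq
    (hdiff : ∀ {x y}, (x, y) ∈ V → ∀ j m n, DifferentiableAt ℝ (fun x => Γ j x m n) x)
    (hsymm : ∀ {x y}, (x, y) ∈ V → (linearRicci Γ x).IsSymm) (h : (x, y) ∈ V) (i j : Fin 4) :
    finslerRicci F i j x y = linearRicci Γ x i j := by
  have first_deriv {x y : E4} (h : (x, y) ∈ V) (j : Fin 4) :
      dy j (finslerRic F) x y = 2 * (linearRicci Γ x *ᵥ ⇑y) j :=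
    (dy_congr hV (fun h => hΓ.finslerRic_eq hV (hdiff h) h) h j).trans
      (partialDeriv_dotProduct_mulVec_self (hsymm h) j)
  have second_deriv : dy i (dy j (finslerRic F)) x y = 2 * linearRicci Γ x j i := by
    rw [dy_congr hV (fun h => first_deriv h j) h]
    exact (partialDeriv_const_mul _ _ _).trans
      (congrArg (2 * ·) (partialDeriv_dotProduct_coord (linearRicci Γ x j) i))
  rw [finslerRicci, second_deriv, (hsymm h).apply]
  ring

lemma fieldOperator_eq
    (hdiff : ∀ {x y}, (x, y) ∈ V → ∀ j m n, DifferentiableAt ℝ (fun x => Γ j x m n) x)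
    (hsymm : ∀ {x y}, (x, y) ∈ V → (linearRicci Γ x).IsSymm) (h : (x, y) ∈ V) :
    fieldOperator F x y = ((fundamentalTensor F x y)⁻¹ * linearRicci Γ x).trace -
      3 / F x y ^ 2 * (⇑y ⬝ᵥ linearRicci Γ x *ᵥ ⇑y) := by
  simp only [fieldOperator, hΓ.finslerRicci_eq hV hdiff hsymm h, sub_mul, Finset.sum_sub_distrib]
  congr 1
  · simp only [Matrix.trace, Matrix.diag, Matrix.mul_apply]
    exact Finset.sum_congr rfl fun i _ => Finset.sum_congr rfl fun j _ => by
      rw [(hsymm h).apply]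
  · simp only [dotProduct, Matrix.mulVec, Finset.mul_sum]
    exact Finset.sum_congr rfl fun i _ => Finset.sum_congr rfl fun j _ => by ring

end IsBerwaldOn

lemma IsFinslerChart.torsionFree_of_isBerwaldOn {V : Set (E4 × E4)} {F : LocalFun}
    {Γ : Fin 4 → E4 → Matrix (Fin 4) (Fin 4) ℝ} {x y : E4} (hF : IsFinslerChart V F)
    (hΓ : IsBerwaldOn V F Γ) (h : (x, y) ∈ V) (i j k : Fin 4) : Γ j x i k = Γ k x i j := by
  rw [← hΓ.dy_cartanConnection hF.isOpen h, hF.dy_cartanConnection_comm h,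
    hΓ.dy_cartanConnection hF.isOpen h]

/-- The norm `α = √(a_ij(x) yⁱ yʲ)` of the metric `a`. -/
def metricNorm (a : E4 → Matrix (Fin 4) (Fin 4) ℝ) : LocalFun := fun x y => √(⇑y ⬝ᵥ a x *ᵥ ⇑y)

/-- On the bundle coordinates `V` over the positions `U`, the Finsler function `F` is of Randers
type, `F = α + β` with `α` the norm of the metric `a` and `β = bᵢ yⁱ`. The metric has no prescribed
signature, but it takes negative values on every fiber. -/
structure IsRandersChart (U : Set E4) (V : Set (E4 × E4)) (a : E4 → Matrix (Fin 4) (Fin 4) ℝ)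
    (b : E4 → Fin 4 → ℝ) (F : LocalFun) : Prop where
  finsler : IsFinslerChart V F
  metric : IsMetricChart U a
  form_smooth : ∀ i, ContDiffOn ℝ ∞ (fun x => b x i) U
  mem_base : ∀ {x y}, (x, y) ∈ V → x ∈ U
  nonempty_fiber : ∀ x ∈ U, ∃ y, (x, y) ∈ V
  exists_neg : ∀ x ∈ U, ∃ v, v ⬝ᵥ a x *ᵥ v < 0
  pos : ∀ {x y}, (x, y) ∈ V → 0 < ⇑y ⬝ᵥ a x *ᵥ ⇑y
  eq_add : ∀ {x y}, (x, y) ∈ V → F x y = metricNorm a x y + b x ⬝ᵥ ⇑y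

/-- The part of `F³ (gⁱʲ - (3 / F²) yⁱ yʲ) S_ij` rational in `y`, for the Randers metric
`F = α + β` of the metric `a` and the form `b`, and a symmetric tensor `S` annihilating the gradient
`aⁱʲ bⱼ`. -/
def fieldRationalPart (a S : Matrix (Fin 4) (Fin 4) ℝ) (b : Fin 4 → ℝ) (y : E4) : ℝ :=
  2 * ((b ⬝ᵥ ⇑y) * ((a⁻¹ * S).trace * (⇑y ⬝ᵥ a *ᵥ ⇑y) - ⇑y ⬝ᵥ S *ᵥ ⇑y))

/-- The coefficient of `α` in `F³ (gⁱʲ - (3 / F²) yⁱ yʲ) S_ij`, the counterpart of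
`fieldRationalPart`. -/
def fieldIrrationalPart (a S : Matrix (Fin 4) (Fin 4) ℝ) (b : Fin 4 → ℝ) (y : E4) : ℝ :=
  (a⁻¹ * S).trace * (⇑y ⬝ᵥ a *ᵥ ⇑y + (b ⬝ᵥ ⇑y) ^ 2) +
    (b ⬝ᵥ a⁻¹ *ᵥ b - 3) * (⇑y ⬝ᵥ S *ᵥ ⇑y)

section FieldParts

variable {a S : Matrix (Fin 4) (Fin 4) ℝ} {b : Fin 4 → ℝ}

lemma contDiff_dotProduct_coord {n : WithTop ℕ∞} (c : Fin 4 → ℝ) :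
    ContDiff ℝ n (fun y : E4 => c ⬝ᵥ ⇑y) := by
  unfold dotProduct
  fun_prop

lemma contDiff_dotProduct_mulVec_self {n : WithTop ℕ∞} (S : Matrix (Fin 4) (Fin 4) ℝ) :
    ContDiff ℝ n (fun y : E4 => ⇑y ⬝ᵥ S *ᵥ ⇑y) := by
  unfold Matrix.mulVec dotProduct
  fun_prop

lemma contDiff_fieldRationalPart {n : WithTop ℕ∞} : ContDiff ℝ n (fieldRationalPart a S b) :=
  contDiff_const.mul ((contDiff_dotProduct_coord b).mul
    ((contDiff_const.mul (contDiff_dotProduct_mulVec_self a)).sub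
      (contDiff_dotProduct_mulVec_self S)))

lemma contDiff_fieldIrrationalPart {n : WithTop ℕ∞} : ContDiff ℝ n (fieldIrrationalPart a S b) :=
  (contDiff_const.mul ((contDiff_dotProduct_mulVec_self a).add
    ((contDiff_dotProduct_coord b).pow 2))).add
      (contDiff_const.mul (contDiff_dotProduct_mulVec_self S))

-- Where `b ≠ 0` the rational part gives `y·S y = tr(a⁻¹ S) y·a y`, and where `b = 0` the other one
-- gives `3 y·S y = tr(a⁻¹ S) y·a y`. Both contradict the trace unless `S = 0`, as `1, 3 ≠ 4`.
lemma eq_zero_of_fieldParts_eq_zero (ha : IsUnit a.det) (hsymm : a.IsSymm) (hS : S.IsSymm)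
    (hrational : fieldRationalPart a S b = 0) (hirrational : fieldIrrationalPart a S b = 0) :
    S = 0 := by
  rcases eq_or_ne b 0 with rfl | hb
  · refine eq_zero_of_mul_dotProduct_mulVec_self_eq (c := 3) ha hsymm hS (by norm_num)
      (by norm_num) fun v => ?_
    have hv := congrFun hirrational (WithLp.toLp 2 v)
    simp only [fieldIrrationalPart, zero_dotProduct, Pi.zero_apply] at hv
    linear_combination -hv
  · have hne : ∃ y : E4, b ⬝ᵥ ⇑y ≠ 0 := by
      by_contra! h
      exact hb (dotProduct_eq_zero b fun v => h (WithLp.toLp 2 v))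
    have hprop := eq_zero_of_mul_eq_zero_of_contDiff_omega (contDiff_dotProduct_coord b)
      (g := fun y : E4 => (a⁻¹ * S).trace * (⇑y ⬝ᵥ a *ᵥ ⇑y) - ⇑y ⬝ᵥ S *ᵥ ⇑y)
      ((contDiff_const.mul (contDiff_dotProduct_mulVec_self a)).sub
        (contDiff_dotProduct_mulVec_self S))
      (fun y => (mul_eq_zero.1 (congrFun hrational y)).resolve_left two_ne_zero) hne
    refine eq_zero_of_mul_dotProduct_mulVec_self_eq (c := 1) ha hsymm hS one_ne_zero
      (by norm_num) fun v => ?_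
    rw [one_mul, ← sub_eq_zero.1 (congrFun hprop (WithLp.toLp 2 v))]

end FieldParts

section Randers

variable {U : Set E4} {V : Set (E4 × E4)} {a : E4 → Matrix (Fin 4) (Fin 4) ℝ} {b : E4 → Fin 4 → ℝ}
  {F : LocalFun} {Γ : Fin 4 → E4 → Matrix (Fin 4) (Fin 4) ℝ} {x y : E4}

lemma dy_metricNorm (ha : (a x).IsSymm) (hy : 0 < ⇑y ⬝ᵥ a x *ᵥ ⇑y) (i : Fin 4) :
    dy i (metricNorm a) x y = (metricNorm a x y)⁻¹ * (a x *ᵥ ⇑y) i := by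
  refine (partialDeriv_sqrt (differentiableAt_dotProduct_mulVec_self (a x)) hy.ne' i).trans ?_
  rw [partialDeriv_dotProduct_mulVec_self ha, mul_div_mul_left _ _ two_ne_zero, div_eq_inv_mul]
  rfl

lemma differentiableAt_metricNorm (hy : 0 < ⇑y ⬝ᵥ a x *ᵥ ⇑y) :
    DifferentiableAt ℝ (metricNorm a x) y :=
  (differentiableAt_dotProduct_mulVec_self (a x)).sqrt hy.ne'

section

variable (ha : ∀ i j, DifferentiableAt ℝ (fun x => a x i j) x)
include ha

lemma differentiableAt_mulVec_const_dotProduct (v : Fin 4 → ℝ) :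
    DifferentiableAt ℝ (fun x => (a x *ᵥ v) ⬝ᵥ v) x :=
  differentiableAt_dotProduct_const (fun m => differentiableAt_dotProduct_const (ha m) v) v

lemma dx_metricNorm (hy : 0 < ⇑y ⬝ᵥ a x *ᵥ ⇑y) (i : Fin 4) :
    dx i (metricNorm a) x y = (⇑y ⬝ᵥ matrixDeriv i a x *ᵥ ⇑y) / (2 * metricNorm a x y) := by
  simp only [dx, metricNorm, dotProduct_comm ⇑y] at hy ⊢
  refine (partialDeriv_sqrt (differentiableAt_mulVec_const_dotProduct ha ⇑y) hy.ne' i).trans ?_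
  rw [partialDeriv_dotProduct_const (b := fun x => a x *ᵥ ⇑y)
    (fun m => differentiableAt_dotProduct_const (ha m) ⇑y), covectorDeriv_mulVec_const ha]

lemma differentiableAt_metricNorm_const (hy : 0 < ⇑y ⬝ᵥ a x *ᵥ ⇑y) :
    DifferentiableAt ℝ (fun x => metricNorm a x y) x := by
  simp only [metricNorm, dotProduct_comm ⇑y] at hy ⊢
  exact (differentiableAt_mulVec_const_dotProduct ha ⇑y).sqrt hy.ne'

end

namespace IsRandersChart

variable (hR : IsRandersChart U V a b F)
include hR

section

variable (hx : x ∈ U)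
include hx

lemma contDiffAt_form (m : Fin 4) : ContDiffAt ℝ 2 (fun x => b x m) x :=
  ((hR.form_smooth m).contDiffAt (hR.metric.isOpen.mem_nhds hx)).of_le two_le_infty

lemma differentiableAt_form (m : Fin 4) : DifferentiableAt ℝ (fun x => b x m) x :=
  (hR.contDiffAt_form hx m).differentiableAt two_ne_zero

end

section

variable (h : (x, y) ∈ V)
include h

lemma isSymm : (a x).IsSymm := hR.metric.isSymm (hR.mem_base h)

lemma metricNorm_ne_zero : metricNorm a x y ≠ 0 := (Real.sqrt_pos.2 (hR.pos h)).ne'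

lemma metricNorm_sq : metricNorm a x y ^ 2 = ⇑y ⬝ᵥ a x *ᵥ ⇑y := Real.sq_sqrt (hR.pos h).le

lemma dy_eq (i : Fin 4) : dy i F x y = (metricNorm a x y)⁻¹ * (a x *ᵥ ⇑y) i + b x i := by
  rw [dy_congr hR.finsler.isOpen hR.eq_add h, ← dy_metricNorm (hR.isSymm h) (hR.pos h)]
  exact (partialDeriv_add (differentiableAt_metricNorm (hR.pos h))
    (differentiableAt_dotProduct_coord (b x)) i).trans
      (congrArg (_ + ·) (partialDeriv_dotProduct_coord (b x) i))

lemma dx_eq (j : Fin 4) : dx j F x y =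
    (⇑y ⬝ᵥ matrixDeriv j a x *ᵥ ⇑y) / (2 * metricNorm a x y) + covectorDeriv j b x ⬝ᵥ ⇑y := by
  have ha := hR.metric.differentiableAt (hR.mem_base h)
  have hb := hR.differentiableAt_form (hR.mem_base h)
  rw [dx_congr hR.finsler.isOpen hR.eq_add h, ← dx_metricNorm ha (hR.pos h),
    ← partialDeriv_dotProduct_const hb]
  exact partialDeriv_add (differentiableAt_metricNorm_const ha (hR.pos h))
    (differentiableAt_dotProduct_const hb ⇑y) j

lemma dy_dy_eq (i j : Fin 4) : dy i (dy j F) x y = (metricNorm a x y)⁻¹ * (a x i j -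
    ((metricNorm a x y)⁻¹ * (a x *ᵥ ⇑y) i) * ((metricNorm a x y)⁻¹ * (a x *ᵥ ⇑y) j)) := by
  have hnorm := differentiableAt_metricNorm (hR.pos h)
  have hα := hR.metricNorm_ne_zero h
  have hlin := differentiableAt_dotProduct_coord (x := y) (a x j)
  have deriv_inv : partialDeriv i (fun y => (metricNorm a x y)⁻¹) y =
      -((metricNorm a x y)⁻¹ * (a x *ᵥ ⇑y) i) / metricNorm a x y ^ 2 := by
    rw [partialDeriv_inv hnorm hα, ← dy_metricNorm (hR.isSymm h) (hR.pos h)]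
    rfl
  have deriv_const : partialDeriv i (fun y => (metricNorm a x y)⁻¹ * (a x *ᵥ ⇑y) j + b x j) y =
      partialDeriv i (fun y => (metricNorm a x y)⁻¹ * (a x j ⬝ᵥ ⇑y)) y :=
    (partialDeriv_add ((hnorm.fun_inv hα).fun_mul hlin) (differentiableAt_const _) i).trans
      (by rw [partialDeriv_const, add_zero])
  rw [dy_congr hR.finsler.isOpen (fun h => hR.dy_eq h j) h]
  refine deriv_const.trans ?_
  rw [partialDeriv_mul (hnorm.fun_inv hα) hlin, deriv_inv, partialDeriv_dotProduct_coord,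
    (hR.isSymm h).apply]
  change _ * (a x *ᵥ ⇑y) j + _ = _
  field_simp
  ring

lemma fundamentalTensor_eq :
    fundamentalTensor F x y = randersTensor (a x) (b x) ⇑y (metricNorm a x y) := by
  ext i j
  rw [hR.finsler.fundamentalTensor_eq_dy_dy h, hR.dy_dy_eq h, hR.dy_eq h, hR.dy_eq h, hR.eq_add h]
  simp only [randersTensor, Matrix.add_apply, Matrix.sub_apply, Matrix.smul_apply,
    Matrix.vecMulVec_apply, Pi.add_apply, Pi.smul_apply, smul_eq_mul]
  ring

-- This is `δⱼ F = 0`, with the terms rational in `y` separated from the multiples of `α`.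
lemma tensorCovDeriv_add_metricNorm_mul_eq_zero (hΓ : IsBerwaldOn V F Γ) (j : Fin 4) :
    ⇑y ⬝ᵥ tensorCovDeriv Γ j a x *ᵥ ⇑y +
      metricNorm a x y * (2 * (covectorCovDeriv Γ j b x ⬝ᵥ ⇑y)) = 0 := by
  have hα := hR.metricNorm_ne_zero h
  have horizontal : Γ j x *ᵥ ⇑y ⬝ᵥ ((metricNorm a x y)⁻¹ • a x *ᵥ ⇑y + b x) = dx j F x y := by
    rw [← hR.finsler.sum_cartanConnection_mul_dy h j]
    exact Finset.sum_congr rfl fun i _ => by rw [hΓ x y h, hR.dy_eq h]; rfl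
  have transposed : ⇑y ⬝ᵥ ((Γ j x)ᵀ * a x) *ᵥ ⇑y = ⇑y ⬝ᵥ (a x * Γ j x) *ᵥ ⇑y := by
    rw [← (hR.isSymm h).eq, ← Matrix.transpose_mul, Matrix.mulVec_transpose,
      dotProduct_comm, ← Matrix.dotProduct_mulVec, (hR.isSymm h).eq]
  have lowered : Γ j x *ᵥ ⇑y ⬝ᵥ a x *ᵥ ⇑y = ⇑y ⬝ᵥ (a x * Γ j x) *ᵥ ⇑y := by
    rw [dotProduct_mulVec_comm (hR.isSymm h), Matrix.mulVec_mulVec]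
  rw [hR.dx_eq h, dotProduct_add, dotProduct_smul, lowered, dotProduct_comm _ (b x),
    Matrix.dotProduct_mulVec (b x), smul_eq_mul] at horizontal
  rw [tensorCovDeriv, covectorCovDeriv, Matrix.sub_mulVec, Matrix.add_mulVec, dotProduct_sub,
    dotProduct_add, transposed, sub_dotProduct]
  field_simp at horizontal
  linear_combination -horizontal

end

lemma isOpen_fiber : IsOpen {y | (x, y) ∈ V} := hR.finsler.isOpen.preimage (by fun_prop)

section

variable (hx : x ∈ U)
include hx

-- A fiber is open, so there a polynomial and a polynomial multiple of the irrational `α` can only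
-- cancel if both vanish.
lemma eq_zero_of_add_metricNorm_mul_eq_zero {f g : E4 → ℝ} (hf : ContDiff ℝ ω f)
    (hg : ContDiff ℝ ω g) (h : ∀ y, (x, y) ∈ V → f y + metricNorm a x y * g y = 0) :
    f = 0 ∧ g = 0 := by
  obtain ⟨v, hv⟩ := hR.exists_neg x hx
  exact eq_zero_of_add_sqrt_mul_eq_zero hf hg (contDiff_dotProduct_mulVec_self (a x))
    hR.isOpen_fiber (hR.nonempty_fiber x hx) (fun _ => hR.pos) ⟨WithLp.toLp 2 v, hv⟩ h

lemma isSymm_tensorCovDeriv (j : Fin 4) : (tensorCovDeriv Γ j a x).IsSymm := by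
  have hsymm := hR.metric.isSymm hx
  have hderiv : (matrixDeriv j a x).IsSymm :=
    Matrix.IsSymm.ext fun i k => hR.metric.matrixDeriv_apply_comm hx j k i
  rw [Matrix.IsSymm, tensorCovDeriv, Matrix.transpose_sub, Matrix.transpose_add,
    Matrix.transpose_mul, Matrix.transpose_mul, Matrix.transpose_transpose, hderiv.eq, hsymm.eq,
    add_comm (a x * _)]

variable (hΓ : IsBerwaldOn V F Γ)
include hΓ

lemma tensorCovDeriv_eq_zero_and_covectorCovDeriv_eq_zero (j : Fin 4) :
    tensorCovDeriv Γ j a x = 0 ∧ covectorCovDeriv Γ j b x = 0 := by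
  obtain ⟨hquad, hlin⟩ := hR.eq_zero_of_add_metricNorm_mul_eq_zero hx
    (f := fun y => ⇑y ⬝ᵥ tensorCovDeriv Γ j a x *ᵥ ⇑y)
    (g := fun y => 2 * (covectorCovDeriv Γ j b x ⬝ᵥ ⇑y))
    (contDiff_dotProduct_mulVec_self _) (contDiff_const.mul (contDiff_dotProduct_coord _))
    fun y h => hR.tensorCovDeriv_add_metricNorm_mul_eq_zero h hΓ j
  refine ⟨eq_zero_of_dotProduct_mulVec_self_eq_zero (hR.isSymm_tensorCovDeriv hx j)
    fun v => congrFun hquad (WithLp.toLp 2 v), dotProduct_eq_zero _ fun v => ?_⟩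
  exact (mul_eq_zero.1 (congrFun hlin (WithLp.toLp 2 v))).resolve_left two_ne_zero

lemma eq_leviCivita (j : Fin 4) : Γ j x = leviCivita a j x := by
  obtain ⟨y, h⟩ := hR.nonempty_fiber x hx
  exact hR.metric.eq_leviCivita_of_torsionFree_of_compatible hx
    (hR.finsler.torsionFree_of_isBerwaldOn hΓ h)
    (fun j => (hR.tensorCovDeriv_eq_zero_and_covectorCovDeriv_eq_zero hx hΓ j).1) j

omit hx in
lemma isBerwaldOn_leviCivita : IsBerwaldOn V F (leviCivita a) := fun x y h i j => by
  rw [hΓ x y h, hR.eq_leviCivita (hR.mem_base h) hΓ]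

lemma linearRicci_leviCivita_mulVec_eq_zero :
    linearRicci (leviCivita a) x *ᵥ ((a x)⁻¹ *ᵥ b x) = 0 :=
  hR.metric.linearRicci_mulVec_eq_zero_of_parallel hx (hR.contDiffAt_form hx)
    (Filter.eventually_of_mem (hR.metric.isOpen.mem_nhds hx) fun _ hx j =>
      (hR.tensorCovDeriv_eq_zero_and_covectorCovDeriv_eq_zero hx
        (hR.isBerwaldOn_leviCivita hΓ) j).2)

omit hx in
lemma pow_three_mul_fieldOperator_eq (h : (x, y) ∈ V) :
    F x y ^ 3 * fieldOperator F x y =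
      fieldRationalPart (a x) (linearRicci (leviCivita a) x) (b x) y +
        metricNorm a x y * fieldIrrationalPart (a x) (linearRicci (leviCivita a) x) (b x) y := by
  have hF := hR.finsler.ne_zero h
  have hg := hR.finsler.det_ne_zero h
  have hx := hR.mem_base h
  rw [hR.eq_add h] at hF
  rw [hR.fundamentalTensor_eq h] at hg
  rw [(hR.isBerwaldOn_leviCivita hΓ).fieldOperator_eq hR.finsler.isOpen
      (fun h => hR.metric.differentiableAt_leviCivita (hR.mem_base h))
      (fun h => hR.metric.isSymm_linearRicci_leviCivita (hR.mem_base h)) h,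
    hR.fundamentalTensor_eq h, trace_randersTensor_inv_mul (hR.metric.isUnit_det hx)
      (hR.isSymm h) (hR.metric.isSymm_linearRicci_leviCivita hx)
      (hR.linearRicci_leviCivita_mulVec_eq_zero hx hΓ) (hR.metricNorm_ne_zero h) hF
      (hR.metricNorm_sq h) hg.isUnit, hR.eq_add h, fieldRationalPart,
    fieldIrrationalPart, ← hR.metricNorm_sq h]
  field_simp
  ring

lemma linearRicci_leviCivita_eq_zero
    (hfield : ∀ y, (x, y) ∈ V → fieldOperator F x y = 0) : linearRicci (leviCivita a) x = 0 := by
  obtain ⟨hrational, hirrational⟩ := hR.eq_zero_of_add_metricNorm_mul_eq_zero hx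
    contDiff_fieldRationalPart contDiff_fieldIrrationalPart
    fun y h => by rw [← hR.pow_three_mul_fieldOperator_eq hΓ h, hfield y h, mul_zero]
  exact eq_zero_of_fieldParts_eq_zero (hR.metric.isUnit_det hx) (hR.metric.isSymm hx)
    (hR.metric.isSymm_linearRicci_leviCivita hx) hrational hirrational

theorem fieldOperator_eq_zero_iff :
    (∀ y, (x, y) ∈ V → fieldOperator F x y = 0) ↔ ∀ i j, ricci a i j x = 0 := by
  simp only [hR.metric.ricci_eq_linearRicci hx]
  refine ⟨fun hfield i j => by rw [hR.linearRicci_leviCivita_eq_zero hx hΓ hfield]; rfl,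
    fun hricci y h => ?_⟩
  have hzero : linearRicci (leviCivita a) x = 0 := Matrix.ext hricci
  have hproduct : F x y ^ 3 * fieldOperator F x y = 0 := by
    simp only [hR.pow_three_mul_fieldOperator_eq hΓ h, hzero, fieldRationalPart,
      fieldIrrationalPart, mul_zero, Matrix.trace_zero, Matrix.zero_mulVec, dotProduct_zero,
      zero_mul, sub_zero, add_zero]
  exact (mul_eq_zero.1 hproduct).resolve_left (pow_ne_zero 3 (hR.finsler.ne_zero h))

end

end IsRandersChart

end Randers

section Manifold

variable {M : Type*} [TopologicalSpace M] [ChartedSpace E4 M]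

/-- The components `bᵢ = b(∂ᵢ)` of a `1`-form in the chart `φ`. -/
def localForm (φ : OpenPartialHomeomorph M E4) (b : ∀ p : M, TangentSpace 𝓘(ℝ, E4) p →L[ℝ] ℝ)
    (x : E4) (i : Fin 4) : ℝ :=
  b (φ.symm x) (coordVector φ x (EuclideanSpace.single i 1))

/-- The bundle coordinates, in the chart `φ`, of the points of a subset `A` of the tangent
bundle. -/
def chartDomain (φ : OpenPartialHomeomorph M E4) (A : Set (TangentBundle 𝓘(ℝ, E4) M)) :
    Set (E4 × E4) :=
  φ.target ×ˢ Set.univ ∩ (fun p => coordPoint φ p.1 p.2) ⁻¹' A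

lemma coordVector_smul (φ : OpenPartialHomeomorph M E4) (x y : E4) (c : ℝ) :
    coordVector φ x (c • y) = c • coordVector φ x y :=
  (mfderiv 𝓘(ℝ, E4) 𝓘(ℝ, E4) φ.symm x).map_smul c y

lemma coordVector_eq_sum (φ : OpenPartialHomeomorph M E4) (x y : E4) :
    coordVector φ x y = ∑ i, y i • coordVector φ x (EuclideanSpace.single i 1) := by
  have hsum : y = ∑ i, y i • (EuclideanSpace.single i 1 : E4) := by
    simpa using ((EuclideanSpace.basisFun (Fin 4) ℝ).sum_repr y).symm
  conv_lhs => rw [hsum]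
  exact (map_sum (mfderiv 𝓘(ℝ, E4) 𝓘(ℝ, E4) φ.symm x) _ _).trans
    (Finset.sum_congr rfl fun i _ => coordVector_smul φ x _ _)

lemma apply_coordVector_coordVector (φ : OpenPartialHomeomorph M E4)
    (a : ∀ p : M, TangentSpace 𝓘(ℝ, E4) p →L[ℝ] TangentSpace 𝓘(ℝ, E4) p →L[ℝ] ℝ) (x y : E4) :
    a (φ.symm x) (coordVector φ x y) (coordVector φ x y) = ⇑y ⬝ᵥ localMetric φ a x *ᵥ ⇑y := by
  rw [coordVector_eq_sum]
  simp only [map_sum, map_smul, sum_apply, smul_apply, smul_eq_mul, dotProduct, Matrix.mulVec,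
    localMetric, Matrix.of_apply, Finset.mul_sum]
  rw [Finset.sum_comm]
  exact Finset.sum_congr rfl fun i _ => Finset.sum_congr rfl fun j _ => by ring

lemma apply_coordVector (φ : OpenPartialHomeomorph M E4)
    (b : ∀ p : M, TangentSpace 𝓘(ℝ, E4) p →L[ℝ] ℝ) (x y : E4) :
    b (φ.symm x) (coordVector φ x y) = localForm φ b x ⬝ᵥ ⇑y := by
  rw [coordVector_eq_sum, map_sum]
  exact Finset.sum_congr rfl fun i _ => (map_smul _ _ _).trans (mul_comm _ _)

lemma tangentMapWithin_symm (φ : OpenPartialHomeomorph M E4) {x : E4} (hx : x ∈ φ.target)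
    (y : E4) : tangentMapWithin 𝓘(ℝ, E4) 𝓘(ℝ, E4) φ.symm φ.target ⟨x, y⟩ = coordPoint φ x y := by
  simp only [tangentMapWithin, coordPoint, coordVector, mfderivWithin_of_isOpen φ.open_target hx]

lemma contMDiff_toTangentBundle {E : Type*} [NormedAddCommGroup E] [NormedSpace ℝ E]
    {n : WithTop ℕ∞} :
    ContMDiff 𝓘(ℝ, E × E) 𝓘(ℝ, E).tangent n
      (fun p : E × E => (⟨p.1, p.2⟩ : TangentBundle 𝓘(ℝ, E) E)) := by
  intro p
  rw [Bundle.contMDiffAt_totalSpace]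
  refine ⟨contMDiff_iff_contDiff.2 contDiff_fst p, ?_⟩
  simpa using (contMDiff_iff_contDiff.2 contDiff_snd p)

variable {φ : OpenPartialHomeomorph M E4} {x : E4}

lemma surjective_coordVector (hφ : φ ∈ IsManifold.maximalAtlas 𝓘(ℝ, E4) ∞ M)
    (hx : x ∈ φ.target) : Function.Surjective (coordVector φ x) := by
  have h : φ.MDifferentiable 𝓘(ℝ, E4) 𝓘(ℝ, E4) :=
    ⟨(contMDiffOn_of_mem_maximalAtlas hφ).mdifferentiableOn (by simp),
      (contMDiffOn_symm_of_mem_maximalAtlas hφ).mdifferentiableOn (by simp)⟩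
  exact h.symm.mfderiv_surjective hx

variable [IsManifold 𝓘(ℝ, E4) ∞ M] (hφ : φ ∈ IsManifold.maximalAtlas 𝓘(ℝ, E4) ∞ M)
include hφ

lemma contMDiffOn_coordPoint :
    ContMDiffOn 𝓘(ℝ, E4 × E4) 𝓘(ℝ, E4).tangent ∞ (fun p : E4 × E4 => coordPoint φ p.1 p.2)
      (φ.target ×ˢ Set.univ) :=
  (((contMDiffOn_symm_of_mem_maximalAtlas hφ).contMDiffOn_tangentMapWithin (m := ∞) (by simp)
    φ.open_target.uniqueMDiffOn).comp contMDiff_toTangentBundle.contMDiffOn fun _ hp => hp.1).congr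
      fun p hp => (tangentMapWithin_symm φ hp.1 p.2).symm

lemma contMDiffOn_coordPoint_const (v : E4) :
    ContMDiffOn 𝓘(ℝ, E4) 𝓘(ℝ, E4).tangent ∞ (fun x => coordPoint φ x v) φ.target :=
  (contMDiffOn_coordPoint hφ).comp
    (contMDiff_iff_contDiff.2 (contDiff_id.prodMk contDiff_const)).contMDiffOn
    fun _ hx => ⟨hx, Set.mem_univ _⟩

lemma contDiffOn_localForm (b : OneForm M) (i : Fin 4) :
    ContDiffOn ℝ ∞ (fun x => localForm φ b.val x i) φ.target := by
  rw [← contMDiffOn_iff_contDiffOn]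
  intro x hx
  have hb := b.smooth.contMDiffAt.comp_contMDiffWithinAt x
    (contMDiffOn_symm_of_mem_maximalAtlas hφ x hx)
  exact (Bundle.contMDiffWithinAt_totalSpace.1
    (ContMDiffWithinAt.clm_bundle_apply (E₂ := Bundle.Trivial M ℝ) hb
      (contMDiffOn_coordPoint_const hφ (EuclideanSpace.single i 1) x hx))).2

lemma contDiffOn_localMetric (a : LorentzianMetric M) (i j : Fin 4) :
    ContDiffOn ℝ ∞ (fun x => localMetric φ a.val x i j) φ.target := by
  rw [← contMDiffOn_iff_contDiffOn]
  intro x hx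
  have ha := a.smooth.contMDiffAt.comp_contMDiffWithinAt x
    (contMDiffOn_symm_of_mem_maximalAtlas hφ x hx)
  exact (Bundle.contMDiffWithinAt_totalSpace.1
    (ContMDiffWithinAt.clm_bundle_apply₂ (E₃ := Bundle.Trivial M ℝ) ha
      (contMDiffOn_coordPoint_const hφ (EuclideanSpace.single i 1) x hx)
      (contMDiffOn_coordPoint_const hφ (EuclideanSpace.single j 1) x hx))).2

lemma FinslerSpacetime.isFinslerChart (S : FinslerSpacetime M) :
    IsFinslerChart (chartDomain φ S.domain) (localExpr φ S.F) where
  isOpen := (contMDiffOn_coordPoint hφ).continuousOn.isOpen_inter_preimage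
    (φ.open_target.prod isOpen_univ) S.isOpen_domain
  smooth := contMDiffOn_iff_contDiffOn.1
    (S.smooth.comp ((contMDiffOn_coordPoint hφ).mono Set.inter_subset_left) fun _ hp => hp.2)
  homogeneous {x y c} h hc := by
    rw [localExpr, coordPoint, coordVector_smul]
    exact S.homogeneous _ _ c hc h.2
  det_ne_zero h := (S.lorentzian φ hφ _ h.1.1 _ h.2).det_ne_zero

lemma LorentzianMetric.isMetricChart (a : LorentzianMetric M) :
    IsMetricChart φ.target (localMetric φ a.val) where
  isOpen := φ.open_target
  smooth := contDiffOn_localMetric hφ a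
  isSymm _ := Matrix.IsSymm.ext fun _ _ => a.symm _ _ _
  isUnit_det hx := (a.lorentzian φ hφ _ hx).det_ne_zero.isUnit

lemma FinslerSpacetime.IsRanders.isRandersChart {S : FinslerSpacetime M} {a : LorentzianMetric M}
    {b : OneForm M} (hS : S.IsRanders a b) :
    IsRandersChart φ.target (chartDomain φ S.domain) (localMetric φ a.val) (localForm φ b.val)
      (localExpr φ S.F) where
  finsler := S.isFinslerChart hφ
  metric := a.isMetricChart hφ
  form_smooth := contDiffOn_localForm hφ b
  mem_base h := h.1.1
  nonempty_fiber x hx := by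
    obtain ⟨v, hv⟩ := S.nonempty_fiber (φ.symm x)
    obtain ⟨y, rfl⟩ := surjective_coordVector hφ hx v
    exact ⟨y, ⟨hx, Set.mem_univ y⟩, hv⟩
  exists_neg x hx := (a.lorentzian φ hφ x hx).exists_dotProduct_mulVec_neg
  pos h := by
    rw [← apply_coordVector_coordVector]
    exact (hS _ _ h.2).1
  eq_add h := by
    rw [metricNorm, ← apply_coordVector_coordVector, ← apply_coordVector]
    exact (hS _ _ h.2).2

lemma FinslerSpacetime.IsBerwald.exists_isBerwaldOn {S : FinslerSpacetime M} (hS : S.IsBerwald) :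
    ∃ Γ, IsBerwaldOn (chartDomain φ S.domain) (localExpr φ S.F) Γ := by
  obtain ⟨Γ, hΓ⟩ := hS φ hφ
  exact ⟨fun j x => Matrix.of fun i k => Γ i j k x, fun x y h i j => hΓ x h.1.1 y h.2 i j⟩

end Manifold

end FinslerGravity

end

theorem mainTheorem3 {M : Type*} [TopologicalSpace M] [ChartedSpace FinslerGravity.E4 M]
    [IsManifold 𝓘(ℝ, FinslerGravity.E4) ∞ M]
    (S : FinslerGravity.FinslerSpacetime M) (a : FinslerGravity.LorentzianMetric M)
    (b : FinslerGravity.OneForm M) (hRanders : S.IsRanders a b) (hBerwald : S.IsBerwald) :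
    S.SolvesVacuumFinslerGravity ↔ a.SolvesVacuumEinstein := by
  refine forall₄_congr fun φ hφ x hx => ?_
  obtain ⟨Γ, hΓ⟩ := hBerwald.exists_isBerwaldOn hφ
  rw [← (hRanders.isRandersChart hφ).fieldOperator_eq_zero_iff hx hΓ]
  exact forall_congr' fun y => ⟨fun h hy => h hy.2, fun h hy => h ⟨⟨hx, Set.mem_univ y⟩, hy⟩⟩
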